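/- **Setting.** Let $\mathcal A$ be a set of observable actions, partitioned into high-level actions $\mathcal A_{\mathcal H}$ and low-level actions $\mathcal A_{\mathcal L}$, and let $\tau\notin\mathcal A$, $\mathcal A_\tau=\mathcal A\cup\{\tau\}$. Nondeterministic process terms $N\in\mathbb P_{\rm n}$ and probabilistic process terms $P\in\mathbb P_{\rm p}$ are given by $$N::=\underline 0\mid a.P\mid N+N\mid N\parallel_L N\mid N\setminus L\mid N/L\mid N\!K,\qquad P::=\textstyle\bigoplus_{i\in I}[p_i]N_i\mid P\parallel_L P\mid P\setminus L\mid P/L\mid P\!K,$$ with $a\in\mathcal A_\tau$, $L\subseteq\mathcal A$, $I$ finite and non-empty, $p_i\in(0,1]$, $\sum_i p_i=1$, and constants $N\!K,P\!K$ with fixed defining equations whose right-hand sides have every constant in the scope of an action prefix. Let $\mathbb P=\mathbb P_{\rm n}\cup\mathbb P_{\rm p}$. Action transitions $N\xrightarrow{a}P$ are generated by the usual rules for prefix, $+$ and constants, together with: if $a\notin L$, $N_1\xrightarrow{a}P_1$ gives $N_1\parallel_L N_2\xrightarrow{a}P_1\parallel_L[1]N_2$, and symmetrically; if $a\in L$,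 $N_1\xrightarrow aP_1$ and $N_2\xrightarrow aP_2$ give $N_1\parallel_L N_2\xrightarrow aP_1\parallel_L P_2$; $N\setminus L\xrightarrow aP\setminus L$ if $N\xrightarrow aP$ and $a\notin L$; if $N\xrightarrow aP$ then $N/L\xrightarrow{b}P/L$, where $b=\tau$ if $a\in L$ and $b=a$ otherwise. Probabilistic transitions $P\xrightarrow{p}N$ form a multirelation: $\bigoplus_i[p_i]N_i\xrightarrow{p_j}N_j$ for every $j\in I$, probabilities are multiplied by $\parallel_L$, and $\setminus L$, $/L$ and constants leave them unchanged. The set $\mathrm{reach}(E)$ consists of all $E'$ to which there is a finite, possibly empty, sequence of transitions from $E$, and of $[1]N$ for every such nondeterministic $E'=N$. We write $s\Rightarrow s'$ if there is a finite, possibly empty, sequence of $\tau$-transitions and probabilistic transitions from $s$ to $s'$. For $C\subseteq\mathbb P$ let $\mathrm{prob}(s,C)$ be $\sum\{p\mid s\xrightarrow ps',\,s'\in C\}$ (with multiplicities) if $s\in\mathbb P_{\rm p}$, and $1$ or $0$ according to whether $s\in C$ or not if $s\in\mathbb P_{\rm n}$. A deterministic scheduler $\sigma$ for $s$ maps each computation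 $\theta$ from $s$ to an action transition of the last state of $\theta$ or to $\bot$ (halt). For $\Phi\subseteq\mathcal A_\tau^*$ let $\mathrm{prob}_\sigma(s,\Phi,C)=X(\varepsilon_s,\Phi)$, where $\varepsilon_s$ is the empty computation and $X\ge 0$ is the smallest solution of the following equations, $t$ being the last state of $\theta$: $X(\theta,\Phi)=1$ if $\varepsilon\in\Phi$, $t\in C$ and $\sigma(\theta)=\bot$; otherwise, $X(\theta,\Phi)=\sum_{t\xrightarrow pt'}p\,X(\theta\,p\,t',\Phi)$ if $t\in\mathbb P_{\rm p}$, $X(\theta,\Phi)=X(\theta\,a\,t',\{\alpha\mid a\alpha\in\Phi\})$ if $\sigma(\theta)=(t\xrightarrow at')$, and $X(\theta,\Phi)=0$ if $t\in\mathbb P_{\rm n}$ and $\sigma(\theta)=\bot$. Processes $s_1,s_2$ are *weakly probabilistic bisimilar*, $s_1\approx_{\rm pw}s_2$ (resp. *probabilistic branching bisimilar*, $s_1\approx_{\rm pb}s_2$), if they are related by some equivalence relation $\mathcal B$ on $\mathbb P$ such that, whenever $(s_1,s_2)\in\mathcal B$, $\mathrm{prob}(s_1,C)=\mathrm{prob}(s_2,C)$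 for every equivalence class $C$ of $\mathcal B$, and for each $s_1\xrightarrow as_1'$: - (pw) there is a scheduler $\sigma$ for $s_2$ with $\mathrm{prob}_\sigma(s_2,\Phi_a,[s_1']_{\mathcal B})=1$, where $\Phi_a=\tau^*a\tau^*$ if $a\ne\tau$ and $\Phi_\tau=\tau^*$; - (pb) either $a=\tau$ and $(s_1',s_2)\in\mathcal B$, or there are $s_2\Rightarrow\bar s_2\xrightarrow as_2'$ with $(s_1,\bar s_2)\in\mathcal B$ and $(s_1',s_2')\in\mathcal B$. For $\approx\,\in\{\approx_{\rm pw},\approx_{\rm pb}\}$ and $E\in\mathbb P$: - $E\in\mathrm{SBSNNI}_\approx$ iff $E'\setminus\mathcal A_{\mathcal H}\approx E'/\mathcal A_{\mathcal H}$ for all $E'\in\mathrm{reach}(E)$; - $E\in\mathrm{P\_BNDC}_\approx$ iff $E'\setminus\mathcal A_{\mathcal H}\approx((E'\parallel_LF)/L)\setminus\mathcal A_{\mathcal H}$ for all $E'\in\mathrm{reach}(E)$, all $L\subseteq\mathcal A_{\mathcal H}$ and all $F$ of the same kind (nondeterministic or probabilistic) as $E'$ all of whose executable actions belong to $\mathcal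 A_{\mathcal H}$; - $E\in\mathrm{SBNDC}_\approx$ iff $E'\setminus\mathcal A_{\mathcal H}\approx E''\setminus\mathcal A_{\mathcal H}$ for all $E',E''\in\mathrm{reach}(E)$ and $h\in\mathcal A_{\mathcal H}$ with $E'\xrightarrow hE''$. **Theorem.** Let $\approx\,\in\{\approx_{\rm pw},\approx_{\rm pb}\}$, $\mathcal P\in\{\mathrm{SBSNNI}_\approx,\mathrm{P\_BNDC}_\approx,\mathrm{SBNDC}_\approx\}$, $E\in\mathbb P$, and let $E_1,E_2$ both belong to $\mathbb P_{\rm n}$ or both belong to $\mathbb P_{\rm p}$. 1. If $E\in\mathbb P_{\rm p}$ and $E\in\mathcal P$, then $a.E\in\mathcal P$ for all $a\in\mathcal A_{\mathcal L}\cup\{\tau\}$. 2. If $\approx$ is $\approx_{\rm pb}$ and $E_1,E_2\in\mathcal P$, then $E_1\parallel_LE_2\in\mathcal P$ for all $L\subseteq\mathcal A_{\mathcal L}$, and, when $\mathcal P=\mathrm{SBNDC}_{\approx_{\rm pb}}$, for all $L\subseteq\mathcal A$. 3. If $E\in\mathcal P$, then $E\setminus L\in\mathcal P$ for all $L\subseteq\mathcal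 A$. 4. If $E\in\mathcal P$, then $E/L\in\mathcal P$ for all $L\subseteq\mathcal A_{\mathcal L}$. Moreover, part 2 fails for $\approx_{\rm pw}$: if there are a high-level action and four distinct low-level actions, then for each of the three properties $\mathcal P$ based on $\approx_{\rm pw}$ there are $N_1,N_2\in\mathbb P_{\rm n}$ and $L\subseteq\mathcal A_{\mathcal L}$ with $N_1,N_2\in\mathcal P$ and $N_1\parallel_LN_2\notin\mathcal P$. -/

import Mathlib

open scoped NNReal ENNReal

universe u v

namespace PNI

/-- The two kinds of process terms (and of states): nondeterministic and probabilistic. -/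
inductive Kind : Type
  | nd : Kind
  | pr : Kind

/-- Process terms over the observable actions `A`, with process constants `K k` of kind `k`.
An element of `Option A` is an action of `A ∪ {τ}`, where `none` is `τ`.
`Term A K .nd` is the set of nondeterministic process terms,
`Term A K .pr` the set of probabilistic ones. -/
inductive Term (A : Type u) (K : Kind → Type v) : Kind → Type (max u v)
  /-- the terminated process -/
  | nil : Term A K .nd
  /-- action prefix `a . P` -/
  | pre (a : Option A) (P : Term A K .pr) : Term A K .nd
  /-- alternative composition `N₁ + N₂` -/
  | alt (N₁ N₂ : Term A K .nd) : Term A K .nd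
  /-- probabilistic choice `⨁ᵢ [pᵢ] Nᵢ`, with `pᵢ > 0` and `∑ pᵢ = 1`
  (so that the index set is not empty and `pᵢ ≤ 1`) -/
  | choice {m : ℕ} (p : Fin m → ℝ≥0) (hpos : ∀ i, 0 < p i) (hsum : ∑ i, p i = 1)
      (N : Fin m → Term A K .nd) : Term A K .pr
  /-- parallel composition with synchronization set `L` -/
  | par {k : Kind} (L : Set A) (E₁ E₂ : Term A K k) : Term A K k
  /-- restriction `E \ L` -/
  | res {k : Kind} (E : Term A K k) (L : Set A) : Term A K k
  /-- hiding `E / L` -/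
  | hide {k : Kind} (E : Term A K k) (L : Set A) : Term A K k
  /-- process constant -/
  | const {k : Kind} (c : K k) : Term A K k

variable {A : Type u} {K : Kind → Type v}

/-- Every occurrence of a process constant is in the scope of an action prefix. -/
def Guarded : {k : Kind} → Term A K k → Prop
  | _, .nil => True
  | _, .pre _ _ => True
  | _, .alt N₁ N₂ => Guarded N₁ ∧ Guarded N₂
  | _, .choice _ _ _ N => ∀ i, Guarded (N i)
  | _, .par _ E₁ E₂ => Guarded E₁ ∧ Guarded E₂
  | _, .res E _ => Guarded E
  | _, .hide E _ => Guarded E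
  | _, .const _ => False

/-- The defining equations of the process constants; their right-hand sides are guarded. -/
structure Equations (A : Type u) (K : Kind → Type v) where
  body : {k : Kind} → K k → Term A K k
  guarded : ∀ {k : Kind} (c : K k), Guarded (body c)

/-- The process `[1] N`. -/
def one (N : Term A K .nd) : Term A K .pr :=
  .choice (m := 1) (fun _ => 1) (fun _ => one_pos) (by simp) (fun _ => N)

/-- Action transitions `N --a--> P`. The condition `a ∈ some '' L` says that `a` is an
observable action that belongs to `L`. -/
inductive Act (D : Equations A K) : Term A K .nd → Option A → Term A K .pr → Prop
  | pre (a : Option A) (P : Term A K .pr) : Act D (.pre a P) a P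
  | altLeft {N₁ N₂ : Term A K .nd} {a : Option A} {P : Term A K .pr} :
      Act D N₁ a P → Act D (.alt N₁ N₂) a P
  | altRight {N₁ N₂ : Term A K .nd} {a : Option A} {P : Term A K .pr} :
      Act D N₂ a P → Act D (.alt N₁ N₂) a P
  | parLeft {L : Set A} {N₁ N₂ : Term A K .nd} {a : Option A} {P₁ : Term A K .pr} :
      Act D N₁ a P₁ → a ∉ some '' L → Act D (.par L N₁ N₂) a (.par L P₁ (one N₂))
  | parRight {L : Set A} {N₁ N₂ : Term A K .nd} {a : Option A} {P₂ : Term A K .pr} :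
      Act D N₂ a P₂ → a ∉ some '' L → Act D (.par L N₁ N₂) a (.par L (one N₁) P₂)
  | synch {L : Set A} {N₁ N₂ : Term A K .nd} {a : Option A} {P₁ P₂ : Term A K .pr} :
      Act D N₁ a P₁ → Act D N₂ a P₂ → a ∈ some '' L →
      Act D (.par L N₁ N₂) a (.par L P₁ P₂)
  | res {L : Set A} {N : Term A K .nd} {a : Option A} {P : Term A K .pr} :
      Act D N a P → a ∉ some '' L → Act D (.res N L) a (.res P L)
  | hideIn {L : Set A} {N : Term A K .nd} {a : Option A} {P : Term A K .pr} :
      Act D N a P → a ∈ some '' L → Act D (.hide N L) none (.hide P L)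
  | hideOut {L : Set A} {N : Term A K .nd} {a : Option A} {P : Term A K .pr} :
      Act D N a P → a ∉ some '' L → Act D (.hide N L) a (.hide P L)
  | const {c : K .nd} {a : Option A} {P : Term A K .pr} :
      Act D (D.body c) a P → Act D (.const c) a P

/-- Probabilistic transitions `P --p--> N`. They form a multirelation: `PTrans D P p N` is the
type of all transitions from `P` to `N` with label `p`, one for each derivation; for instance
`[p] N ⊕ [p] N` has two of them. -/
inductive PTrans (D : Equations A K) : Term A K .pr → ℝ≥0 → Term A K .nd → Type (max u v)
  | choice {m : ℕ} (p : Fin m → ℝ≥0) (hpos : ∀ i, 0 < p i) (hsum : ∑ i, p i = 1)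
      (N : Fin m → Term A K .nd) (j : Fin m) : PTrans D (.choice p hpos hsum N) (p j) (N j)
  | synch {L : Set A} {P₁ P₂ : Term A K .pr} {p₁ p₂ : ℝ≥0} {N₁ N₂ : Term A K .nd} :
      PTrans D P₁ p₁ N₁ → PTrans D P₂ p₂ N₂ →
      PTrans D (.par L P₁ P₂) (p₁ * p₂) (.par L N₁ N₂)
  | res {L : Set A} {P : Term A K .pr} {p : ℝ≥0} {N : Term A K .nd} :
      PTrans D P p N → PTrans D (.res P L) p (.res N L)
  | hide {L : Set A} {P : Term A K .pr} {p : ℝ≥0} {N : Term A K .nd} :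
      PTrans D P p N → PTrans D (.hide P L) p (.hide N L)
  | const {c : K .pr} {p : ℝ≥0} {N : Term A K .nd} :
      PTrans D (D.body c) p N → PTrans D (.const c) p N

/-- All process terms, i.e. the states of the probabilistic labeled transition system. -/
abbrev Proc (A : Type u) (K : Kind → Type v) : Type (max u v) := Σ k : Kind, Term A K k

/-- A process term as a state. -/
abbrev Term.st {k : Kind} (E : Term A K k) : Proc A K := ⟨k, E⟩

/-- One transition of either sort. -/
inductive Step (D : Equations A K) : Proc A K → Proc A K → Prop
  | act {N : Term A K .nd} {a : Option A} {P : Term A K .pr} : Act D N a P → Step D N.st P.st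
  | prob {P : Term A K .pr} {p : ℝ≥0} {N : Term A K .nd} : PTrans D P p N → Step D P.st N.st

/-- One `τ`-transition or one probabilistic transition. -/
inductive TauStep (D : Equations A K) : Proc A K → Proc A K → Prop
  | tau {N : Term A K .nd} {P : Term A K .pr} : Act D N none P → TauStep D N.st P.st
  | prob {P : Term A K .pr} {p : ℝ≥0} {N : Term A K .nd} :
      PTrans D P p N → TauStep D P.st N.st

/-- `s ⟹ s'`: a finite, possibly empty, sequence of `τ`-transitions alternating with
probabilistic transitions. -/
def Weak (D : Equations A K) : Proc A K → Proc A K → Prop := Relation.ReflTransGen (TauStep D)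

/-- `s' ∈ reach(s)`: there is a computation from `s` to `s'`, or `s' = [1] N` where there is a
computation from `s` to `N`. -/
inductive Reach (D : Equations A K) (s : Proc A K) : Proc A K → Prop
  | comp {s' : Proc A K} : Relation.ReflTransGen (Step D) s s' → Reach D s s'
  | one {N : Term A K .nd} : Relation.ReflTransGen (Step D) s N.st → Reach D s (one N).st

open Classical in
/-- The function `prob(s, s')`: total probability of the transitions from `s` to `s'` if `s` is
probabilistic; the point mass at `s` if `s` is nondeterministic. -/
noncomputable def prob (D : Equations A K) : Proc A K → Proc A K → ℝ≥0∞
  | ⟨.pr, P⟩, ⟨.nd, N⟩ => ∑' t : (Σ p : ℝ≥0, PTrans D P p N), (t.1 : ℝ≥0∞)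
  | ⟨.pr, _⟩, ⟨.pr, _⟩ => 0
  | ⟨.nd, N⟩, s' => if s' = ⟨.nd, N⟩ then 1 else 0

/-- `prob(s, C) = ∑_{s' ∈ C} prob(s, s')`. -/
noncomputable def probSet (D : Equations A K) (s : Proc A K) (C : Set (Proc A K)) : ℝ≥0∞ :=
  ∑' s' : C, prob D s s'

/-- Transition labels: actions or probabilities. -/
abbrev Label (A : Type u) : Type u := Option A ⊕ ℝ≥0

/-- The computations from a fixed state `s₀`, as the list of pairs of a label and the state it
leads to, *the most recent step first*; the empty list is the empty computation. -/
abbrev Comp (A : Type u) (K : Kind → Type v) : Type (max u v) := List (Label A × Proc A K)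

/-- The last state of a computation that starts from `s₀`. -/
def lastState (s₀ : Proc A K) : Comp A K → Proc A K
  | [] => s₀
  | x :: _ => x.2

/-- Deterministic schedulers for the computations starting from `s₀`: a computation is mapped to
an action transition of its last state or to `⊥` (`none`, the scheduler halts). -/
structure Scheduler (D : Equations A K) (s₀ : Proc A K) where
  next : Comp A K → Option (Option A × Term A K .pr)
  valid : ∀ θ a P, next θ = some (a, P) →
    ∃ N : Term A K .nd, lastState s₀ θ = N.st ∧ Act D N a P

/-- `Φ - a`, the words `α` such that `a α ∈ Φ`. -/
def quot (Φ : Set (List (Option A))) (a : Option A) : Set (List (Option A)) :=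
  {α | a :: α ∈ Φ}

open Classical in
/-- The right-hand side of the system of equations for the probabilities, under `σ`, of halting
in `C` after a computation whose remaining trace is in `Φ`. The unknowns are indexed by the
current computation `θ` (whose last state is the current state) and by `Φ`. -/
noncomputable def schedRHS (D : Equations A K) {s₀ : Proc A K} (σ : Scheduler D s₀)
    (C : Set (Proc A K)) (X : Comp A K → Set (List (Option A)) → ℝ≥0∞)
    (θ : Comp A K) (Φ : Set (List (Option A))) : ℝ≥0∞ :=
  if [] ∈ Φ ∧ lastState s₀ θ ∈ C ∧ σ.next θ = none then 1
  else
    match lastState s₀ θ with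
    | ⟨.nd, _⟩ =>
      match σ.next θ with
      | none => 0
      | some (a, P) => X ((.inl a, P.st) :: θ) (quot Φ a)
    | ⟨.pr, P⟩ =>
      ∑' t : (Σ (p : ℝ≥0) (N : Term A K .nd), PTrans D P p N),
        (t.1 : ℝ≥0∞) * X ((.inr t.1, t.2.1.st) :: θ) Φ

theorem schedRHS_mono (D : Equations A K) {s₀ : Proc A K} (σ : Scheduler D s₀)
    (C : Set (Proc A K)) : Monotone (schedRHS D σ C) := by
  intro X Y hXY θ Φ
  unfold schedRHS
  split_ifs with h
  · exact le_rfl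
  · split
    · split
      · exact le_rfl
      · exact hXY _ _
    · exact ENNReal.tsum_le_tsum fun t => mul_le_mul_right (hXY _ _) _

/-- `prob_σ(s, Φ, C, ε_s)`: the value, at the empty computation, of the smallest solution of the
system of equations. -/
noncomputable def schedProb (D : Equations A K) {s : Proc A K} (σ : Scheduler D s)
    (Φ : Set (List (Option A))) (C : Set (Proc A K)) : ℝ≥0∞ :=
  OrderHom.lfp ⟨schedRHS D σ C, schedRHS_mono D σ C⟩ [] Φ

/-- The language `τ* â τ*`, which is `τ*` if `a = τ` and `τ* a τ*` otherwise. -/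
def weakTraces : Option A → Set (List (Option A))
  | none => {α | ∃ m : ℕ, α = List.replicate m none}
  | some a => {α | ∃ m n : ℕ, α = List.replicate m none ++ some a :: List.replicate n none}

/-- Weak probabilistic bisimulations. -/
structure IsWeakProbBisim (D : Equations A K) (B : Setoid (Proc A K)) : Prop where
  act : ∀ (N : Term A K .nd) (s₂ : Proc A K), B N.st s₂ → ∀ (a : Option A) (P : Term A K .pr),
    Act D N a P → ∃ σ : Scheduler D s₂, schedProb D σ (weakTraces a) {t | B t P.st} = 1
  prob : ∀ s₁ s₂ : Proc A K, B s₁ s₂ → ∀ C ∈ B.classes, probSet D s₁ C = probSet D s₂ C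

/-- Probabilistic branching bisimulations. -/
structure IsProbBranchingBisim (D : Equations A K) (B : Setoid (Proc A K)) : Prop where
  act : ∀ (N : Term A K .nd) (s₂ : Proc A K), B N.st s₂ → ∀ (a : Option A) (P : Term A K .pr),
    Act D N a P →
      (a = none ∧ B P.st s₂) ∨
      ∃ (N' : Term A K .nd) (P' : Term A K .pr),
        Weak D s₂ N'.st ∧ Act D N' a P' ∧ B N.st N'.st ∧ B P.st P'.st
  prob : ∀ s₁ s₂ : Proc A K, B s₁ s₂ → ∀ C ∈ B.classes, probSet D s₁ C = probSet D s₂ C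

/-- The two behavioral equivalences: `pw` is weak probabilistic bisimilarity, `pb` is
probabilistic branching bisimilarity. -/
inductive BisimKind : Type
  | pw : BisimKind
  | pb : BisimKind

/-- `s₁ ≈ s₂` for the chosen equivalence. -/
def Bisimilar (D : Equations A K) : BisimKind → Proc A K → Proc A K → Prop
  | .pw, s₁, s₂ => ∃ B : Setoid (Proc A K), IsWeakProbBisim D B ∧ B s₁ s₂
  | .pb, s₁, s₂ => ∃ B : Setoid (Proc A K), IsProbBranchingBisim D B ∧ B s₁ s₂

/-- Every action that the process can ever execute belongs to the set `H`
(in particular it is not `τ`). -/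
def ActionsIn (D : Equations A K) (H : Set A) (s : Proc A K) : Prop :=
  ∀ (N : Term A K .nd) (a : Option A) (P : Term A K .pr),
    Reach D s N.st → Act D N a P → a ∈ some '' H

/-- Bisimulation-based strong nondeterministic non-interference: `E \ H ≈ E / H`. -/
def BSNNI (D : Equations A K) (H : Set A) (e : BisimKind) {k : Kind} (E : Term A K k) : Prop :=
  Bisimilar D e (E.res H).st (E.hide H).st

/-- Bisimulation-based non-deducibility on composition:
`E \ H ≈ ((E ∥_L F) / L) \ H` for all high-level `F` of the kind of `E` and all `L ⊆ H`. -/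
def BNDC (D : Equations A K) (H : Set A) (e : BisimKind) {k : Kind} (E : Term A K k) : Prop :=
  ∀ F : Term A K k, ActionsIn D H F.st → ∀ L : Set A, L ⊆ H →
    Bisimilar D e (E.res H).st (((Term.par L E F).hide L).res H).st

/-- The three local noninterference properties. -/
inductive Property : Type
  | SBSNNI : Property
  | P_BNDC : Property
  | SBNDC : Property

/-- The process `E` has the noninterference property based on the equivalence `e`,
where `H` is the set of high-level actions and `Hᶜ` the set of low-level ones. -/
def Secure (D : Equations A K) (H : Set A) (e : BisimKind) :
    Property → {k : Kind} → Term A K k → Prop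
  | .SBSNNI, _, E => ∀ (k' : Kind) (E' : Term A K k'), Reach D E.st E'.st → BSNNI D H e E'
  | .P_BNDC, _, E => ∀ (k' : Kind) (E' : Term A K k'), Reach D E.st E'.st → BNDC D H e E'
  | .SBNDC, _, E => ∀ (E' : Term A K .nd) (E'' : Term A K .pr) (h : A), h ∈ H →
      Reach D E.st E'.st → Reach D E.st E''.st → Act D E' (some h) E'' →
      Bisimilar D e (E'.res H).st (E''.res H).st

end PNI

/-! All three properties reduce to a local condition (`secure_iff`). For every reachable high-level
transition from `N` to `P`, the view `N \ H` must be able to answer a silent move into the class of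
`P \ H`; for SBNDC the two views must be bisimilar. Indeed `E / H` and `((E ∥_L F) / L) \ H` do what
`E \ H` does, plus silent moves stemming from high-level transitions, and matched moves of this kind
are harmless (`bisimilar_of_interference`). Conversely, hiding, or a tester that performs one
high-level action, exposes each single transition.

Closure is then a question about the local condition. Restriction and low-level hiding copy
low-level transitions up to a relabelling that keeps `τ` (`IsLowContext`), so they preserve
bisimilarity of views and answers. For `pb`, bisimilarity of views is a congruence for parallel
composition (`par_res_bisimilar`): the silent preparation of a branching answer ends in the class
where it started, so the components can get ready one after the other.

For `pw` this breaks down. In `highSaturated`, the action `h` only adds a summand `a . 0`, which a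
weak answer imitates by `a . τ`. Next to `tossing`, a synchronized `a` leads to `([1/2] b . 0 ⊕
[1/2] c . 0) ∥ 0`, while the imitation has to resolve the choice before the `τ`, and by then no
single state has the required distribution.

Two reformulations make the bisimulations workable. Equality of class probabilities becomes an
inequality between expectations (`Lift`), which composes without couplings. Schedulers that succeed
with probability one become `AS`: from each state of some set, a well-founded strategy succeeds with
probability at least one half and otherwise returns to the set. `AS.of_scheduler` and `AS.scheduler`
prove the equivalence, and `AS.transfer` moves `AS` along simulations, whence bisimilarity is an
equivalence and the largest bisimulation. -/

namespace PNI

variable {A : Type u} {K : Kind → Type v}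

/-! ### Expectations over the nondeterministic outcomes of a state -/

/-- All probabilistic transitions of a process. -/
abbrev PTransOf (D : Equations A K) (P : Term A K .pr) : Type (max u v) :=
  Σ (p : ℝ≥0) (N : Term A K .nd), PTrans D P p N

/-- Expected value of `f` over the nondeterministic states in which a state resolves; a
nondeterministic state resolves in itself. -/
noncomputable def ex (D : Equations A K) :
    {k : Kind} → Term A K k → (Term A K .nd → ℝ≥0∞) → ℝ≥0∞
  | .nd, N, f => f N
  | .pr, P, f => ∑' t : PTransOf D P, (t.1 : ℝ≥0∞) * f t.2.1

/-- The nondeterministic states in which a state can resolve. -/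
def Supp (D : Equations A K) : {k : Kind} → Term A K k → Term A K .nd → Prop
  | .nd, N, N' => N = N'
  | .pr, P, N' => ∃ p, Nonempty (PTrans D P p N')

variable {D : Equations A K}

theorem PTrans.pos {P : Term A K .pr} {p : ℝ≥0} {N : Term A K .nd} (h : PTrans D P p N) :
    0 < p := by
  induction h with
  | choice p hpos => exact hpos _
  | synch _ _ h1 h2 => exact mul_pos h1 h2
  | res _ ih => exact ih
  | hide _ ih => exact ih
  | const _ ih => exact ih

/-- Transitions of a probabilistic choice. -/
def transChoice (D : Equations A K) {m : ℕ} (p : Fin m → ℝ≥0) (hpos : ∀ i, 0 < p i)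
    (hsum : ∑ i, p i = 1) (N : Fin m → Term A K .nd) :
    Fin m ≃ PTransOf D (.choice p hpos hsum N) where
  toFun j := ⟨p j, N j, .choice p hpos hsum N j⟩
  invFun t := match t with
    | ⟨_, _, .choice _ _ _ _ j⟩ => j
  left_inv _ := rfl
  right_inv t := by
    obtain ⟨q, M, h⟩ := t
    cases h
    rfl

/-- Transitions of a parallel composition. -/
def transPar (D : Equations A K) (L : Set A) (P₁ P₂ : Term A K .pr) :
    PTransOf D P₁ × PTransOf D P₂ ≃ PTransOf D (.par L P₁ P₂) where
  toFun t := ⟨t.1.1 * t.2.1, .par L t.1.2.1 t.2.2.1, .synch t.1.2.2 t.2.2.2⟩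
  invFun t := match t with
    | ⟨_, _, .synch h₁ h₂⟩ => (⟨_, _, h₁⟩, ⟨_, _, h₂⟩)
  left_inv _ := rfl
  right_inv t := by
    obtain ⟨q, M, h⟩ := t
    cases h
    rfl

/-- Transitions of a restriction. -/
def transRes (D : Equations A K) (L : Set A) (P : Term A K .pr) :
    PTransOf D P ≃ PTransOf D (.res P L) where
  toFun t := ⟨t.1, .res t.2.1 L, .res t.2.2⟩
  invFun t := match t with
    | ⟨_, _, .res h⟩ => ⟨_, _, h⟩
  left_inv _ := rfl
  right_inv t := by
    obtain ⟨q, M, h⟩ := t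
    cases h
    rfl

/-- Transitions of a hiding. -/
def transHide (D : Equations A K) (L : Set A) (P : Term A K .pr) :
    PTransOf D P ≃ PTransOf D (.hide P L) where
  toFun t := ⟨t.1, .hide t.2.1 L, .hide t.2.2⟩
  invFun t := match t with
    | ⟨_, _, .hide h⟩ => ⟨_, _, h⟩
  left_inv _ := rfl
  right_inv t := by
    obtain ⟨q, M, h⟩ := t
    cases h
    rfl

/-- Transitions of a process constant. -/
def transConst (D : Equations A K) (c : K .pr) :
    PTransOf D (D.body c) ≃ PTransOf D (.const c) where
  toFun t := ⟨t.1, t.2.1, .const t.2.2⟩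
  invFun t := match t with
    | ⟨_, _, .const h⟩ => ⟨_, _, h⟩
  left_inv _ := rfl
  right_inv t := by
    obtain ⟨q, M, h⟩ := t
    cases h
    rfl

theorem ex_pr (P : Term A K .pr) (f : Term A K .nd → ℝ≥0∞) :
    ex D P f = ∑' t : PTransOf D P, (t.1 : ℝ≥0∞) * f t.2.1 := rfl

theorem ex_choice {m : ℕ} (p : Fin m → ℝ≥0) (hpos : ∀ i, 0 < p i) (hsum : ∑ i, p i = 1)
    (N : Fin m → Term A K .nd) (f : Term A K .nd → ℝ≥0∞) :
    ex D (.choice p hpos hsum N) f = ∑ i, (p i : ℝ≥0∞) * f (N i) := by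
  rw [ex_pr, ← (transChoice D p hpos hsum N).tsum_eq, tsum_fintype]
  rfl

@[simp] theorem ex_one (N : Term A K .nd) (f : Term A K .nd → ℝ≥0∞) :
    ex D (one N) f = f N := by
  simp [one, ex_choice]

theorem ex_mul_left {k : Kind} (E : Term A K k) (c : ℝ≥0∞) (f : Term A K .nd → ℝ≥0∞) :
    ex D E (fun N => c * f N) = c * ex D E f := by
  cases k with
  | nd => rfl
  | pr =>
    rw [ex_pr, ex_pr, ← ENNReal.tsum_mul_left]
    exact tsum_congr fun t => by ring

theorem ex_add {k : Kind} (E : Term A K k) (f g : Term A K .nd → ℝ≥0∞) :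
    ex D E (fun N => f N + g N) = ex D E f + ex D E g := by
  cases k with
  | nd => rfl
  | pr =>
    rw [ex_pr, ex_pr, ex_pr, ← ENNReal.tsum_add]
    exact tsum_congr fun t => by ring

theorem ex_tsum {ι : Type*} {k : Kind} (E : Term A K k) (f : ι → Term A K .nd → ℝ≥0∞) :
    ex D E (fun N => ∑' i, f i N) = ∑' i, ex D E (f i) := by
  cases k with
  | nd => rfl
  | pr =>
    simp only [ex_pr]
    rw [ENNReal.tsum_comm]
    exact tsum_congr fun t => ENNReal.tsum_mul_left.symm

-- Tonelli: the transitions of a parallel composition are pairs of transitions and their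
-- probabilities multiply.
@[simp] theorem ex_par {k : Kind} (L : Set A) (E₁ E₂ : Term A K k) (f : Term A K .nd → ℝ≥0∞) :
    ex D (.par L E₁ E₂) f = ex D E₁ fun N₁ => ex D E₂ fun N₂ => f (.par L N₁ N₂) := by
  cases k with
  | nd => rfl
  | pr =>
    rw [ex_pr, ← (transPar D L E₁ E₂).tsum_eq, ENNReal.tsum_prod', ex_pr]
    refine tsum_congr fun t => ?_
    rw [ex_pr, ← ENNReal.tsum_mul_left]
    refine tsum_congr fun t' => ?_
    simp [transPar, mul_assoc]

@[simp] theorem ex_res {k : Kind} (L : Set A) (E : Term A K k) (f : Term A K .nd → ℝ≥0∞) :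
    ex D (.res E L) f = ex D E fun N => f (.res N L) := by
  cases k with
  | nd => rfl
  | pr =>
    rw [ex_pr, ← (transRes D L E).tsum_eq]
    rfl

@[simp] theorem ex_hide {k : Kind} (L : Set A) (E : Term A K k) (f : Term A K .nd → ℝ≥0∞) :
    ex D (.hide E L) f = ex D E fun N => f (.hide N L) := by
  cases k with
  | nd => rfl
  | pr =>
    rw [ex_pr, ← (transHide D L E).tsum_eq]
    rfl

theorem ex_const (c : K .pr) (f : Term A K .nd → ℝ≥0∞) :
    ex D (.const c) f = ex D (D.body c) f := by
  rw [ex_pr, ← (transConst D c).tsum_eq]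
  rfl

theorem ex_unit_choice {m : ℕ} (p : Fin m → ℝ≥0) (hpos : ∀ i, 0 < p i) (hsum : ∑ i, p i = 1)
    (N : Fin m → Term A K .nd) :
    ex D (.choice p hpos hsum N) (fun _ => 1) = 1 := by
  rw [ex_choice]
  simp only [mul_one]
  rw [← ENNReal.ofNNReal_finsetSum, hsum, ENNReal.coe_one]

/-- Without guardedness a constant such as `X = X` would have no transition and total mass 0. A
guarded body contains no constant outside a prefix, so a single unfolding reduces `ex_unit` to this
case. -/
theorem ex_unit_of_guarded {k : Kind} (E : Term A K k) (hE : Guarded E) :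
    ex D E (fun _ => 1) = 1 := by
  induction E with
  | nil => rfl
  | pre => rfl
  | alt => rfl
  | choice p hpos hsum N => exact ex_unit_choice p hpos hsum N
  | par L E₁ E₂ ih₁ ih₂ =>
    simp only [Guarded] at hE
    rw [ex_par, ih₂ hE.2, ih₁ hE.1]
  | res E L ih => rw [ex_res, ih hE]
  | hide E L ih => rw [ex_hide, ih hE]
  | const c => exact hE.elim

@[simp] theorem ex_unit {k : Kind} (E : Term A K k) : ex D E (fun _ => 1) = 1 := by
  induction E with
  | nil => rfl
  | pre => rfl
  | alt => rfl
  | choice p hpos hsum N => exact ex_unit_choice p hpos hsum N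
  | par L E₁ E₂ ih₁ ih₂ => rw [ex_par, ih₂, ih₁]
  | res E L ih => rw [ex_res, ih]
  | hide E L ih => rw [ex_hide, ih]
  | @const k c =>
    cases k with
    | nd => rfl
    | pr => rw [ex_const, ex_unit_of_guarded _ (D.guarded c)]

theorem ex_fun_const {k : Kind} (E : Term A K k) (c : ℝ≥0∞) : ex D E (fun _ => c) = c := by
  have := ex_mul_left (D := D) E c (fun _ => 1)
  simpa using this

theorem ex_mono {k : Kind} (E : Term A K k) {f g : Term A K .nd → ℝ≥0∞}
    (h : ∀ N, Supp D E N → f N ≤ g N) : ex D E f ≤ ex D E g := by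
  cases k with
  | nd => exact h _ rfl
  | pr => exact ENNReal.tsum_le_tsum fun t => mul_le_mul_right (h _ ⟨t.1, ⟨t.2.2⟩⟩) _

theorem ex_congr {k : Kind} (E : Term A K k) {f g : Term A K .nd → ℝ≥0∞}
    (h : ∀ N, Supp D E N → f N = g N) : ex D E f = ex D E g :=
  le_antisymm (ex_mono E fun N hN => (h N hN).le) (ex_mono E fun N hN => (h N hN).ge)

theorem ex_pos {k : Kind} {E : Term A K k} {f : Term A K .nd → ℝ≥0∞} {N : Term A K .nd}
    (hN : Supp D E N) (h : 0 < f N) : 0 < ex D E f := by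
  cases k with
  | nd => cases hN; exact h
  | pr =>
    obtain ⟨p, ⟨t⟩⟩ := hN
    refine lt_of_lt_of_le ?_ (ENNReal.le_tsum (⟨p, N, t⟩ : PTransOf D E))
    exact ENNReal.mul_pos (by exact_mod_cast t.pos.ne') h.ne'

theorem exists_supp_of_ex_ne_zero {k : Kind} {E : Term A K k} {f : Term A K .nd → ℝ≥0∞}
    (h : ex D E f ≠ 0) : ∃ N, Supp D E N ∧ f N ≠ 0 := by
  by_contra! hc
  refine h ?_
  rw [ex_congr E hc, ex_fun_const]

theorem supp_nonempty {k : Kind} (E : Term A K k) : ∃ N, Supp D E N := by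
  have : ex D E (fun _ => 1) ≠ 0 := by simp
  obtain ⟨N, hN, -⟩ := exists_supp_of_ex_ne_zero this
  exact ⟨N, hN⟩

/-- The deficit `1 - f` has expectation 0, and every state of the support carries positive mass. -/
theorem eq_one_of_ex_eq_one {k : Kind} {E : Term A K k} {f : Term A K .nd → ℝ≥0∞}
    (hf : ∀ N, f N ≤ 1) (h : ex D E f = 1) {N : Term A K .nd} (hN : Supp D E N) : f N = 1 := by
  by_contra hne
  have h1 : ex D E f + ex D E (fun N => 1 - f N) = 1 := by
    rw [← ex_add]
    refine Eq.trans ?_ (ex_unit (D := D) E)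
    exact ex_congr E fun N _ => add_tsub_cancel_of_le (hf N)
  have h2 : 0 < ex D E (fun N => 1 - f N) :=
    ex_pos hN (tsub_pos_of_lt (lt_of_le_of_ne (hf N) hne))
  rw [h] at h1
  have h3 : ex D E (fun N => 1 - f N) = 0 := by
    have : (1 : ℝ≥0∞) + ex D E (fun N => 1 - f N) = 1 + 0 := by rw [h1, add_zero]
    exact (ENNReal.add_right_inj ENNReal.one_ne_top).1 this
  exact h2.ne' h3

theorem PTrans.supp {P : Term A K .pr} {p : ℝ≥0} {N : Term A K .nd} (h : PTrans D P p N) :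
    Supp D P N := ⟨p, ⟨h⟩⟩

theorem Supp.step {k : Kind} {E : Term A K k} {N : Term A K .nd} (h : Supp D E N) :
    Relation.ReflTransGen (Step D) E.st N.st := by
  cases k with
  | nd => cases h; exact .refl
  | pr => obtain ⟨p, ⟨t⟩⟩ := h; exact .single (.prob t)

theorem Supp.weak {k : Kind} {E : Term A K k} {N : Term A K .nd} (h : Supp D E N) :
    Weak D E.st N.st := by
  cases k with
  | nd => cases h; exact .refl
  | pr => obtain ⟨p, ⟨t⟩⟩ := h; exact .single (.prob t)

theorem supp_one {N M : Term A K .nd} : Supp D (one N) M ↔ M = N := by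
  constructor
  · rintro ⟨p, ⟨h⟩⟩
    generalize hP : one N = P at h
    cases h with
    | choice p hpos hsum N' j =>
      simp only [one, Term.choice.injEq] at hP
      obtain ⟨rfl, hp, hN⟩ := hP
      rw [← eq_of_heq hN]
    | _ => simp [one] at hP
  · rintro rfl
    exact ⟨1, ⟨.choice (m := 1) (fun _ => 1) (fun _ => one_pos) (by simp) (fun _ => M) 0⟩⟩

theorem supp_par {k : Kind} {L : Set A} {E₁ E₂ : Term A K k} {N : Term A K .nd} :
    Supp D (.par L E₁ E₂) N ↔ ∃ N₁ N₂, Supp D E₁ N₁ ∧ Supp D E₂ N₂ ∧ N = .par L N₁ N₂ := by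
  cases k with
  | nd => simp only [Supp]; aesop
  | pr =>
    constructor
    · rintro ⟨p, ⟨h⟩⟩
      cases h with
      | synch h₁ h₂ => exact ⟨_, _, ⟨_, ⟨h₁⟩⟩, ⟨_, ⟨h₂⟩⟩, rfl⟩
    · rintro ⟨N₁, N₂, ⟨p, ⟨h₁⟩⟩, ⟨q, ⟨h₂⟩⟩, rfl⟩
      exact ⟨_, ⟨.synch h₁ h₂⟩⟩

theorem supp_res {k : Kind} {L : Set A} {E : Term A K k} {N : Term A K .nd} :
    Supp D (.res E L) N ↔ ∃ N', Supp D E N' ∧ N = .res N' L := by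
  cases k with
  | nd => simp only [Supp]; aesop
  | pr =>
    constructor
    · rintro ⟨p, ⟨h⟩⟩
      cases h with
      | res h => exact ⟨_, ⟨_, ⟨h⟩⟩, rfl⟩
    · rintro ⟨N', ⟨p, ⟨h⟩⟩, rfl⟩
      exact ⟨_, ⟨.res h⟩⟩

theorem supp_hide {k : Kind} {L : Set A} {E : Term A K k} {N : Term A K .nd} :
    Supp D (.hide E L) N ↔ ∃ N', Supp D E N' ∧ N = .hide N' L := by
  cases k with
  | nd => simp only [Supp]; aesop
  | pr =>
    constructor
    · rintro ⟨p, ⟨h⟩⟩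
      cases h with
      | hide h => exact ⟨_, ⟨_, ⟨h⟩⟩, rfl⟩
    · rintro ⟨N', ⟨p, ⟨h⟩⟩, rfl⟩
      exact ⟨_, ⟨.hide h⟩⟩

open Classical in
theorem probSet_eq_ex {k : Kind} (E : Term A K k) (C : Set (Proc A K)) :
    probSet D E.st C = ex D E fun N => if N.st ∈ C then 1 else 0 := by
  have h0 : probSet D E.st C = ∑' s' : Proc A K, C.indicator (prob D E.st) s' :=
    tsum_subtype C _
  rw [h0]
  cases k with
  | nd =>
    rw [tsum_eq_single E.st]
    · simp [Set.indicator, prob, ex]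
    · intro s hs
      simp [Set.indicator, prob, hs]
  | pr =>
    have hinj : Function.Injective (fun N : Term A K .nd => N.st) := by
      intro N M h
      simpa using h
    rw [← hinj.tsum_eq]
    · rw [ex_pr, ENNReal.tsum_sigma']
      simp only [ENNReal.tsum_sigma']
      rw [ENNReal.tsum_comm]
      refine tsum_congr fun N => ?_
      by_cases h : N.st ∈ C
      · simp [h, prob, ENNReal.tsum_sigma']
      · simp [h]
    · rintro ⟨k, M⟩ hM
      cases k with
      | nd => exact ⟨M, rfl⟩
      | pr => simp [prob] at hM

/-! ### Lifting of relations to resolved states -/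

/-- `Lift D R s s'`: the distributions in which `s` and `s'` resolve are related by `R`. -/
def Lift (D : Equations A K) (R : Proc A K → Proc A K → Prop) (s s' : Proc A K) : Prop :=
  ∀ f g : Term A K .nd → ℝ≥0∞, (∀ N N' : Term A K .nd, R N.st N'.st → f N ≤ g N') →
    ex D s.2 f ≤ ex D s'.2 g

theorem Lift.mono {R R' : Proc A K → Proc A K → Prop} {s s' : Proc A K} (h : Lift D R s s')
    (hR : ∀ s s', R s s' → R' s s') : Lift D R' s s' :=
  fun f g hfg => h f g fun N N' hN => hfg N N' (hR _ _ hN)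

theorem Lift.refl {R : Proc A K → Proc A K → Prop} (hR : ∀ s, R s s) (s : Proc A K) :
    Lift D R s s :=
  fun _ _ hfg => ex_mono _ fun N _ => hfg N N (hR _)

/-- Interpolate by the function that takes at `N'` the supremum of `f` over the `R`-predecessors of
`N'`; no couplings have to be glued. -/
theorem Lift.comp {R R' : Proc A K → Proc A K → Prop} {s s' s'' : Proc A K}
    (h : Lift D R s s') (h' : Lift D R' s' s'') :
    Lift D (fun t t'' => ∃ t', R t t' ∧ R' t' t'') s s'' := by
  intro f g hfg
  refine (h f (fun N' => ⨆ (N : Term A K .nd) (_ : R N.st N'.st), f N) ?_).trans (h' _ g ?_)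
  · intro N N' hN
    exact le_iSup₂_of_le N hN le_rfl
  · intro N' N'' hN'
    exact iSup₂_le fun N hN => hfg N N'' ⟨_, hN, hN'⟩

/-- The indicator of the support of `s` has expectation 1, hence so has the indicator of its
`R`-image, which is therefore 1 on the whole support of `s'`. -/
theorem Lift.exists_left {R : Proc A K → Proc A K → Prop} {s s' : Proc A K} (h : Lift D R s s')
    {N' : Term A K .nd} (hN' : Supp D s'.2 N') : ∃ N, Supp D s.2 N ∧ R N.st N'.st := by
  classical
  by_contra! hc
  have h1 := h (fun N => if Supp D s.2 N then 1 else 0)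
    (fun M' => if ∃ N, Supp D s.2 N ∧ R N.st M'.st then 1 else 0) (by
      intro N M' hR
      by_cases hN : Supp D s.2 N
      · rw [if_pos hN, if_pos ⟨N, hN, hR⟩]
      · simp [hN])
  rw [ex_congr s.2 (g := fun _ => 1) (fun N hN => if_pos hN), ex_unit] at h1
  have h2 : ex D s'.2 (fun M' => if ∃ N, Supp D s.2 N ∧ R N.st M'.st then (1 : ℝ≥0∞) else 0) = 1 :=
    le_antisymm ((ex_mono s'.2 (g := fun _ => 1) fun N _ => by split_ifs <;> simp).trans
      (ex_unit _).le) h1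
  have h3 := eq_one_of_ex_eq_one (fun N => by split_ifs <;> simp) h2 hN'
  rw [if_neg (by push Not; exact hc)] at h3
  exact zero_ne_one h3

theorem Lift.exists_right {R : Proc A K → Proc A K → Prop} {s s' : Proc A K} (h : Lift D R s s')
    {N : Term A K .nd} (hN : Supp D s.2 N) : ∃ N', Supp D s'.2 N' ∧ R N.st N'.st := by
  classical
  have h1 := h (fun M => if M = N then 1 else 0) (fun N' => if R N.st N'.st then 1 else 0) (by
    intro M N' hR
    by_cases hM : M = N
    · subst hM; simp [hR]
    · simp [hM])
  have h2 : 0 < ex D s.2 (fun M => if M = N then 1 else 0) := ex_pos hN (by simp)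
  obtain ⟨N', hN', hne⟩ := exists_supp_of_ex_ne_zero (h2.trans_le h1).ne'
  exact ⟨N', hN', by simpa using hne⟩

/-- Replacing `f` by its supremum on each class gives a function whose expectation depends on the
class probabilities only, and which lies between `f` and `g`. -/
theorem lift_of_probSet {B : Setoid (Proc A K)} {s s' : Proc A K}
    (h : ∀ C ∈ B.classes, probSet D s C = probSet D s' C) : Lift D B s s' := by
  classical
  intro f g hfg
  set F : Quotient B → ℝ≥0∞ := fun c => ⨆ (N : Term A K .nd) (_ : ⟦N.st⟧ = c), f N with hF
  have key : ∀ {k : Kind} (E : Term A K k),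
      ex D E (fun N => F ⟦N.st⟧) = ∑' c : Quotient B, F c * probSet D E.st {t | ⟦t⟧ = c} := by
    intro k E
    have : (fun N : Term A K .nd => F ⟦N.st⟧) = fun N : Term A K .nd =>
        ∑' c : Quotient B, F c * if N.st ∈ {t | (⟦t⟧ : Quotient B) = c} then 1 else 0 := by
      funext N
      rw [tsum_eq_single (⟦N.st⟧ : Quotient B)]
      · simp
      · intro c hc
        simp [Ne.symm hc]
    rw [this, ex_tsum]
    refine tsum_congr fun c => ?_
    rw [ex_mul_left, probSet_eq_ex]
    congr!
  calc ex D s.2 f ≤ ex D s.2 (fun N => F ⟦N.st⟧) :=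
        ex_mono _ fun N _ => le_iSup₂_of_le N rfl le_rfl
    _ = ex D s'.2 (fun N => F ⟦N.st⟧) := by
        rw [key, key]
        refine tsum_congr fun c => ?_
        congr 1
        refine h _ ?_
        induction c using Quotient.inductionOn with
        | h t =>
          refine ⟨t, ?_⟩
          ext x
          exact Quotient.eq
    _ ≤ ex D s'.2 g := ex_mono _ fun N' _ =>
        iSup₂_le fun N hN => hfg N N' (Quotient.exact hN)

theorem probSet_le_of_lift {R : Proc A K → Proc A K → Prop} {s s' : Proc A K} (h : Lift D R s s')
    {C : Set (Proc A K)} (hC : ∀ t t', R t t' → t ∈ C → t' ∈ C) :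
    probSet D s C ≤ probSet D s' C := by
  classical
  have e1 := probSet_eq_ex (D := D) s.2 C
  have e2 := probSet_eq_ex (D := D) s'.2 C
  refine e1.le.trans (le_trans (h _ _ ?_) e2.ge)
  intro N N' hR
  by_cases hN : N.st ∈ C
  · simp [hN, hC _ _ hR hN]
  · simp [hN]

end PNI

namespace PNI

variable {A : Type u} {K : Kind → Type v} {D : Equations A K}

/-! ### Almost sure weak transitions -/

/-- `Play D C W m s q`: by a well-founded strategy from `s`, a state of `C` is reached with
probability at least `q` while performing the trace `τ* m̂ τ*`, and the strategy is otherwise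
given up in states, with the part of the trace still to be performed, that satisfy `W`. -/
inductive Play (D : Equations A K) (C : Set (Proc A K)) (W : Option A → Proc A K → Prop) :
    Option A → Proc A K → ℝ≥0∞ → Prop
  | halt {s : Proc A K} : s ∈ C → Play D C W none s 1
  | defer {m : Option A} {s : Proc A K} : W m s → Play D C W m s 0
  | tau {m : Option A} {N : Term A K .nd} {P : Term A K .pr} {q : ℝ≥0∞} :
      Act D N none P → Play D C W m P.st q → Play D C W m N.st q
  | vis {a : A} {N : Term A K .nd} {P : Term A K .pr} {q : ℝ≥0∞} :
      Act D N (some a) P → Play D C W none P.st q → Play D C W (some a) N.st q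
  | flip {m : Option A} {P : Term A K .pr} (q : Term A K .nd → ℝ≥0∞) :
      (∀ N, Supp D P N → Play D C W m N.st (q N)) → Play D C W m P.st (ex D P q)
  | weaken {m : Option A} {s : Proc A K} {q q' : ℝ≥0∞} :
      Play D C W m s q → q' ≤ q → Play D C W m s q'

/-- `AS D C m s`: by some scheduler, a state of `C` is reached from `s` almost surely while
performing the trace `τ* m̂ τ*`. -/
def AS (D : Equations A K) (C : Set (Proc A K)) (m : Option A) (s : Proc A K) : Prop :=
  ∃ W : Option A → Proc A K → Prop, W m s ∧ ∀ m t, W m t → Play D C W m t 2⁻¹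

variable {C C' : Set (Proc A K)} {W W' : Option A → Proc A K → Prop} {m : Option A}
  {s : Proc A K} {q : ℝ≥0∞}

theorem Play.le_one (h : Play D C W m s q) : q ≤ 1 := by
  induction h with
  | halt => exact le_rfl
  | defer => exact zero_le_one
  | tau _ _ ih => exact ih
  | vis _ _ ih => exact ih
  | flip q _ ih => exact (ex_mono _ ih).trans (ex_unit _).le
  | weaken _ h ih => exact h.trans ih

theorem Play.mono (h : Play D C W m s q) (hC : C ⊆ C') (hW : ∀ m t, W m t → W' m t) :
    Play D C' W' m s q := by
  induction h with
  | halt h => exact .halt (hC h)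
  | defer h => exact .defer (hW _ _ h)
  | tau h _ ih => exact .tau h ih
  | vis h _ ih => exact .vis h ih
  | flip q _ ih => exact .flip q ih
  | weaken _ h ih => exact .weaken ih h

theorem Play.resolve {k : Kind} {E : Term A K k} (q : Term A K .nd → ℝ≥0∞)
    (h : ∀ N, Supp D E N → Play D C W m N.st (q N)) : Play D C W m E.st (ex D E q) := by
  cases k with
  | nd => exact h E rfl
  | pr => exact .flip q h

/-- The bound is `q + (1 - q) * δ`: resuming rescues at least the fraction `δ` of the mass that was
given up. It is affine in `q` and so passes through expectations. -/
theorem Play.resume {δ : ℝ≥0∞} (hδ : δ ≤ 1) (h : Play D C W m s q)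
    (hW : ∀ m t, W m t → Play D C W' m t δ) : Play D C W' m s ((1 - δ) * q + δ) := by
  induction h with
  | halt h => exact .weaken (.halt h) (by rw [mul_one, tsub_add_cancel_of_le hδ])
  | defer h => simpa using hW _ _ h
  | tau h _ ih => exact .tau h ih
  | vis h _ ih => exact .vis h ih
  | @flip m P q _ ih =>
    have := Play.flip _ ih
    rwa [ex_add, ex_mul_left, ex_fun_const] at this
  | weaken _ h ih => exact .weaken ih (by gcongr)

/-- At most one of the two trace requirements is visible, so `m.or m₂` is their concatenation. -/
theorem Play.seq {m₂ : Option A} {r : ℝ≥0∞} (h : Play D C W m s q) (hm : m = none ∨ m₂ = none)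
    (hC : ∀ t ∈ C, Play D C' W' m₂ t r) (hW : ∀ m t, W m t → (m = none ∨ m₂ = none) →
      W' (m.or m₂) t) : Play D C' W' (m.or m₂) s (q * r) := by
  induction h with
  | halt h => simpa using hC _ h
  | defer h => rw [zero_mul]; exact .defer (hW _ _ h hm)
  | tau h _ ih => exact .tau h (ih hm)
  | vis h _ ih =>
    obtain rfl : m₂ = none := by simpa using hm
    exact .vis h (ih (.inl rfl))
  | @flip m P q _ ih =>
    have := Play.flip _ fun N hN => ih N hN hm
    simp only [mul_comm _ r, ex_mul_left] at this
    rwa [mul_comm]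
  | weaken _ h ih => exact .weaken (ih hm) (by gcongr)

theorem AS.play (h : AS D C m s) : Play D C (AS D C) m s 2⁻¹ := by
  obtain ⟨W, hs, hW⟩ := h
  exact (hW _ _ hs).mono subset_rfl fun m t ht => ⟨W, ht, hW⟩

/-- `AS D C` is the largest admissible set of states to give up in: a play that gives up only there
can be resumed, which rescues half of the missing mass. -/
theorem Play.almostSurely (h : Play D C (AS D C) m s q) : AS D C m s := by
  refine ⟨fun m t => ∃ q, Play D C (AS D C) m t q, ⟨q, h⟩, ?_⟩
  rintro m t ⟨q, ht⟩
  refine .weaken (ht.resume (δ := 2⁻¹) (by simp) fun m t h => ?_) le_add_self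
  exact h.play.mono subset_rfl fun m t ht => ⟨0, .defer ht⟩

/-- Each further round of resumption halves the probability of not yet having succeeded. -/
theorem AS.play_near (h : AS D C m s) (n : ℕ) :
    Play D C (AS D C) m s (1 - 2⁻¹ ^ n) := by
  induction n generalizing m s with
  | zero => simpa using Play.defer h
  | succ n ih =>
    refine .weaken ((ih h).resume (δ := 2⁻¹) (by simp) fun m t h => h.play) ?_
    rw [ENNReal.one_sub_inv_two, ENNReal.mul_sub (by simp), mul_one, pow_succ, mul_comm]
    refine tsub_le_iff_right.2 ?_
    have h1 : (2⁻¹ : ℝ≥0∞) ^ n ≤ 1 := pow_le_one' (by simp) n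
    have h2 : (2⁻¹ : ℝ≥0∞) * 2⁻¹ ^ n ≤ 2⁻¹ := mul_le_of_le_one_right' h1
    rw [add_right_comm, tsub_add_cancel_of_le h2, ENNReal.inv_two_add_inv_two]

theorem AS.play_lt (h : AS D C m s) {c : ℝ≥0∞} (hc : c < 1) : Play D C (AS D C) m s c := by
  have ht : Filter.Tendsto (fun n : ℕ => (2⁻¹ : ℝ≥0∞) ^ n) Filter.atTop (nhds 0) :=
    ENNReal.tendsto_pow_atTop_nhds_zero_of_lt_one (by simp)
  obtain ⟨n, hn⟩ := (ht.eventually_le_const (tsub_pos_of_lt hc)).exists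
  refine .weaken (h.play_near n) (ENNReal.le_sub_of_add_le_left (by simp) ?_)
  exact (add_le_add_left hn c).trans (tsub_add_cancel_of_le hc.le).le

theorem AS.mono (h : AS D C m s) (hC : C ⊆ C') : AS D C' m s := by
  obtain ⟨W, hs, hW⟩ := h
  exact ⟨W, hs, fun m t ht => (hW m t ht).mono hC fun _ _ h => h⟩

theorem AS.halt (h : s ∈ C) : AS D C none s := (Play.halt h).almostSurely

theorem AS.tau {N : Term A K .nd} {P : Term A K .pr} (h : Act D N none P)
    (hP : AS D C m P.st) : AS D C m N.st := (Play.tau h (.defer hP)).almostSurely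

theorem AS.vis {a : A} {N : Term A K .nd} {P : Term A K .pr} (h : Act D N (some a) P)
    (hP : AS D C none P.st) : AS D C (some a) N.st := (Play.vis h (.defer hP)).almostSurely

theorem AS.resolve {k : Kind} {E : Term A K k} (h : ∀ N, Supp D E N → AS D C m N.st) :
    AS D C m E.st :=
  (Play.resolve (fun _ => 0) fun N hN => .defer (h N hN)).almostSurely

theorem AS.act {a : Option A} {N : Term A K .nd} {P : Term A K .pr} (h : Act D N a P)
    (hP : P.st ∈ C) : AS D C a N.st := by
  cases a with
  | none => exact .tau h (.halt hP)
  | some a => exact .vis h (.halt hP)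

/-- An optimal strategy need not exist; a factor `c < 1` pays for a nearly optimal one. -/
theorem exists_mul_iSup_le {ι : Type*} [Nonempty ι] (f : ι → ℝ≥0∞) (hf : ∀ i, f i ≤ 1)
    {c : ℝ≥0∞} (hc : c < 1) : ∃ i, c * ⨆ i, f i ≤ f i := by
  by_cases h0 : ⨆ i, f i = 0
  · exact ⟨Classical.arbitrary ι, by simp [h0]⟩
  · have htop : ⨆ i, f i ≠ ⊤ := ((iSup_le hf).trans_lt ENNReal.one_lt_top).ne
    have : c * ⨆ i, f i < ⨆ i, f i := by
      conv_rhs => rw [← one_mul (⨆ i, f i)]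
      exact ENNReal.mul_lt_mul_left h0 htop hc
    obtain ⟨i, hi⟩ := lt_iSup_iff.1 this
    exact ⟨i, hi.le⟩

/-- The square root; it splits an admissible loss between two stages of a strategy. -/
theorem exists_lt_one_le_mul_self {c : ℝ≥0∞} (hc : c < 1) : ∃ d < 1, c ≤ d * d := by
  refine ⟨c ^ (2⁻¹ : ℝ), ENNReal.rpow_lt_one hc (by norm_num), ?_⟩
  rw [← ENNReal.rpow_add_of_nonneg _ _ (by norm_num) (by norm_num)]
  norm_num

/-- A family of strategies is lifted along matching distributions. -/
theorem Play.lift {R : Proc A K → Proc A K → Prop} {m' : Option A} {s' : Proc A K}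
    {q : Term A K .nd → ℝ≥0∞} {c c' : ℝ≥0∞} (hq : ∀ N, Supp D s.2 N → q N ≤ 1)
    (hc : c < 1) (hL : Lift D R s s')
    (h : ∀ N N' : Term A K .nd, Supp D s.2 N → R N.st N'.st → Play D C W m' N'.st (c' * q N)) :
    Play D C W m' s' (c' * c * ex D s.2 q) := by
  classical
  let I (N' : Term A K .nd) := {N : Term A K .nd // Supp D s.2 N ∧ R N.st N'.st}
  have hI (N') (hN' : Supp D s'.2 N') : Nonempty (I N') :=
    let ⟨N, hN⟩ := hL.exists_left hN'
    ⟨⟨N, hN⟩⟩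
  -- A state `N'` may be related to several outcomes `N`; it follows a nearly best one among their
  -- strategies.
  have key : Play D C W m' s' (ex D s'.2 fun N' => c' * c * ⨆ i : I N', q i.1) := by
    refine Play.resolve _ fun N' hN' => ?_
    have := hI N' hN'
    obtain ⟨⟨N, hN⟩, hi⟩ := exists_mul_iSup_le (fun i : I N' => q i.1) (fun i => hq _ i.2.1) hc
    exact .weaken (h N N' hN.1 hN.2) (by rw [mul_assoc]; gcongr)
  refine .weaken key ?_
  rw [ex_mul_left]
  gcongr
  calc ex D s.2 q = ex D s.2 (fun N => if Supp D s.2 N then q N else 0) :=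
        ex_congr _ fun N hN => (if_pos hN).symm
    _ ≤ _ := hL _ _ fun N N' hR => ?_
  by_cases hN : Supp D s.2 N
  · rw [if_pos hN]
    exact le_iSup (fun i : I N' => q i.1) ⟨N, hN, hR⟩
  · simp [hN]

/-- Almost sure weak transitions are preserved by weak simulations that relabel actions
according to `G`. -/
theorem AS.transfer {R : Proc A K → Proc A K → Prop} {G : Option A → Option A → Prop}
    (hG : ∀ a, G none a ↔ a = none)
    (hlift : ∀ s s', R s s' → Lift D R s s')
    (hact : ∀ (N : Term A K .nd) (s' : Proc A K) (a a' : Option A) (P : Term A K .pr),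
      R N.st s' → Act D N a P → G a a' → AS D {t | R P.st t} a' s')
    (hC : ∀ t t', t ∈ C → R t t' → t' ∈ C') {s' : Proc A K} {m' : Option A}
    (h : AS D C m s) (hR : R s s') (hm : G m m') : AS D C' m' s' := by
  -- Giving up may happen in the middle of an answer: `m₁` is what the current answer still has to
  -- perform before it reaches a state related to `P`, and `m₂` is what the simulated strategy still
  -- has to perform from `P`.
  let W' : Option A → Proc A K → Prop := fun m' t => ∃ m₁ m₂ m₂' P, (m₁ = none ∨ m₂' = none) ∧
    m' = m₁.or m₂' ∧ G m₂ m₂' ∧ AS D C m₂ P ∧ AS D {t | R P t} m₁ t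
  have main {m : Option A} {s : Proc A K} {q : ℝ≥0∞} (h : Play D C (AS D C) m s q) :
      ∀ s' m', R s s' → G m m' → ∀ c < 1, Play D C' W' m' s' (c * q) := by
    induction h with
    | halt h =>
      intro s' m' hR hm c hc
      obtain rfl := (hG _).1 hm
      exact .weaken (.halt (hC _ _ h hR)) (by simpa using hc.le)
    | @defer m s h =>
      intro s' m' hR hm c hc
      rw [mul_zero]
      exact .defer ⟨none, m, m', s, .inl rfl, by simp, hm, h, .halt hR⟩
    | @tau m N P q hN hP ih =>
      intro s' m' hR hm c hc
      obtain ⟨c₁, hc₁, hc⟩ := exists_lt_one_le_mul_self hc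
      have := (AS.play_lt (hact _ _ _ none _ hR hN ((hG _).2 rfl)) hc₁).seq (.inl rfl)
        (fun t ht => ih t m' ht hm c₁ hc₁)
        (fun m₁ t ht hm₁ => ⟨m₁, m, m', _, hm₁, rfl, hm, hP.almostSurely, ht⟩)
      rw [← mul_assoc] at this
      exact .weaken (by simpa using this) (by gcongr)
    | @vis a N P q hN hP ih =>
      intro s' m' hR hm c hc
      obtain ⟨c₁, hc₁, hc⟩ := exists_lt_one_le_mul_self hc
      have hnone : G none none := (hG _).2 rfl
      have := (AS.play_lt (hact _ _ _ m' _ hR hN hm) hc₁).seq (.inr rfl)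
        (fun t ht => ih t none ht hnone c₁ hc₁)
        (fun m₁ t ht hm₁ => ⟨m₁, none, none, _, hm₁, rfl, hnone, hP.almostSurely, ht⟩)
      rw [← mul_assoc] at this
      exact .weaken (by simpa using this) (by gcongr)
    | @flip m P q hq ih =>
      intro s' m' hR hm c hc
      obtain ⟨c₁, hc₁, hc⟩ := exists_lt_one_le_mul_self hc
      refine .weaken (Play.lift (s := P.st) (c' := c₁) (fun N hN => (hq N hN).le_one) hc₁
        (hlift _ _ hR) fun N N' hN hR => ih N hN _ _ hR hm c₁ hc₁) ?_
      dsimp only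
      gcongr
    | weaken _ hq ih =>
      intro s' m' hR hm c hc
      exact .weaken (ih s' m' hR hm c hc) (by gcongr)
  refine ⟨W', ⟨none, m, m', s, .inl rfl, by simp, hm, h, .halt hR⟩, ?_⟩
  rintro m' t ⟨m₁, m₂, m₂', P, hor, rfl, hm, hP, ht⟩
  -- One factor `c` is lost in finishing the pending answer, one in the simulated play and one in
  -- its imitation, so `c ^ 3` has to stay above one half.
  obtain ⟨d, hd, hd2⟩ := exists_lt_one_le_mul_self (c := 2⁻¹) (by simp)
  obtain ⟨c, hc, hdc⟩ := exists_lt_one_le_mul_self hd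
  have hc3 : 2⁻¹ ≤ c * (c * c) :=
    hd2.trans (mul_le_mul' (hdc.trans (mul_le_of_le_one_right' hc.le)) hdc)
  exact .weaken ((ht.play_lt hc).seq hor (fun t ht => main (hP.play_lt hc) t m₂' ht hm c hc)
    (fun m₁ t ht hm₁ => ⟨m₁, m₂, m₂', _, hm₁, rfl, hm, hP, ht⟩)) hc3

end PNI

namespace PNI

variable {A : Type u} {K : Kind → Type v} {D : Equations A K}

/-! ### Weak traces -/

theorem nil_mem_weakTraces {m : Option A} : [] ∈ weakTraces m ↔ m = none := by
  cases m with
  | none => simp [weakTraces]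
  | some a => simp [weakTraces]

theorem quot_none (m : Option A) : quot (weakTraces m) none = weakTraces m := by
  ext α
  cases m with
  | none =>
    constructor
    · rintro ⟨n, hn⟩
      cases n with
      | zero => simp at hn
      | succ n => exact ⟨n, by simpa [List.replicate_succ] using hn⟩
    · rintro ⟨n, rfl⟩
      exact ⟨n + 1, by simp [List.replicate_succ]⟩
  | some a =>
    constructor
    · rintro ⟨n, k, hn⟩
      cases n with
      | zero => simp at hn
      | succ n => exact ⟨n, k, by simpa [List.replicate_succ] using hn⟩
    · rintro ⟨n, k, rfl⟩
      exact ⟨n + 1, k, by simp [List.replicate_succ]⟩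

theorem quot_some_self (a : A) : quot (weakTraces (some a)) (some a) = weakTraces none := by
  ext α
  constructor
  · rintro ⟨n, k, hn⟩
    cases n with
    | zero => exact ⟨k, by simpa using hn⟩
    | succ n => simp [List.replicate_succ] at hn
  · rintro ⟨n, rfl⟩
    exact ⟨0, n, by simp⟩

theorem quot_some_of_ne {m : Option A} {a : A} (h : m ≠ some a) :
    quot (weakTraces m) (some a) = ∅ := by
  ext α
  simp only [Set.mem_empty_iff_false, iff_false]
  cases m with
  | none =>
    rintro ⟨n, hn⟩
    cases n <;> simp [List.replicate_succ] at hn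
  | some b =>
    rintro ⟨n, k, hn⟩
    cases n with
    | zero => simp at hn; exact h (by rw [hn.1])
    | succ n => simp [List.replicate_succ] at hn

/-! ### The values of a scheduler -/

/-- The smallest solution of the system of equations of a scheduler. -/
noncomputable def schedVal (D : Equations A K) {s₀ : Proc A K} (σ : Scheduler D s₀)
    (C : Set (Proc A K)) : Comp A K → Set (List (Option A)) → ℝ≥0∞ :=
  OrderHom.lfp ⟨schedRHS D σ C, schedRHS_mono D σ C⟩

section
variable {s₀ : Proc A K} {σ : Scheduler D s₀} {C : Set (Proc A K)} {θ : Comp A K}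
  {Φ : Set (List (Option A))} {X : Comp A K → Set (List (Option A)) → ℝ≥0∞}

theorem schedRHS_halt (h : [] ∈ Φ) (hC : lastState s₀ θ ∈ C) (hσ : σ.next θ = none) :
    schedRHS D σ C X θ Φ = 1 := if_pos ⟨h, hC, hσ⟩

theorem schedRHS_act {N : Term A K .nd} {a : Option A} {P : Term A K .pr}
    (hN : lastState s₀ θ = N.st) (hσ : σ.next θ = some (a, P)) :
    schedRHS D σ C X θ Φ = X ((.inl a, P.st) :: θ) (quot Φ a) := by
  unfold schedRHS
  rw [if_neg (by simp [hσ]), hN]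
  simp [hσ]

theorem schedRHS_stop {N : Term A K .nd} (h : ¬ ([] ∈ Φ ∧ lastState s₀ θ ∈ C))
    (hN : lastState s₀ θ = N.st) (hσ : σ.next θ = none) :
    schedRHS D σ C X θ Φ = 0 := by
  unfold schedRHS
  rw [if_neg (by tauto), hN]
  simp [hσ]

/-- In a probabilistic state the halting test thus never depends on the scheduler: a computation
stops there as soon as its trace is complete and the state is in `C`. -/
theorem next_eq_none {P : Term A K .pr} (hP : lastState s₀ θ = P.st) : σ.next θ = none := by
  cases h : σ.next θ with
  | none => rfl
  | some x =>
    obtain ⟨N, hN, -⟩ := σ.valid θ x.1 x.2 h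
    rw [hP] at hN
    simp at hN

theorem schedRHS_prob {P : Term A K .pr} (hP : lastState s₀ θ = P.st)
    (h : ¬ ([] ∈ Φ ∧ lastState s₀ θ ∈ C)) :
    schedRHS D σ C X θ Φ = ∑' t : PTransOf D P, (t.1 : ℝ≥0∞) * X ((.inr t.1, t.2.1.st) :: θ) Φ := by
  unfold schedRHS
  rw [if_neg (by tauto), hP]

theorem schedVal_eq : schedVal D σ C θ Φ = schedRHS D σ C (schedVal D σ C) θ Φ :=
  congrFun (congrFun (OrderHom.map_lfp ⟨schedRHS D σ C, schedRHS_mono D σ C⟩).symm θ) Φ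

theorem schedVal_le (hX : ∀ θ Φ, schedRHS D σ C X θ Φ ≤ X θ Φ) (θ : Comp A K)
    (Φ : Set (List (Option A))) : schedVal D σ C θ Φ ≤ X θ Φ :=
  OrderHom.lfp_le (f := ⟨schedRHS D σ C, schedRHS_mono D σ C⟩) (fun θ Φ => hX θ Φ) θ Φ

theorem schedVal_le_one (θ : Comp A K) (Φ : Set (List (Option A))) : schedVal D σ C θ Φ ≤ 1 := by
  refine schedVal_le (X := fun _ _ => 1) (fun θ Φ => ?_) θ Φ
  by_cases h : [] ∈ Φ ∧ lastState s₀ θ ∈ C ∧ σ.next θ = none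
  · rw [schedRHS_halt h.1 h.2.1 h.2.2]
  · rcases hs : lastState s₀ θ with ⟨_ | _, E⟩
    · cases hσ : σ.next θ with
      | none => rw [schedRHS_stop (fun h' => h ⟨h'.1, h'.2, hσ⟩) hs hσ]; exact zero_le_one
      | some x => rw [schedRHS_act hs (a := x.1) (P := x.2) hσ]
    · rw [schedRHS_prob hs fun h' => h ⟨h'.1, h'.2, next_eq_none hs⟩]
      exact (ex_unit (D := D) E).le

/-- The candidate that is 0 at `∅` and `⊤` elsewhere satisfies the inequalities of a solution,
because quotients of `∅` are empty. -/
theorem schedVal_empty (θ : Comp A K) : schedVal D σ C θ ∅ = 0 := by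
  classical
  refine le_antisymm ((schedVal_le (X := fun _ Φ => if Φ = ∅ then 0 else ⊤) (fun θ Φ => ?_) θ ∅).trans
    (by simp)) zero_le
  by_cases hΦ : Φ = ∅
  · subst hΦ
    rcases hs : lastState s₀ θ with ⟨_ | _, E⟩
    · cases hσ : σ.next θ with
      | none => rw [schedRHS_stop (by simp) hs hσ]; exact zero_le
      | some x =>
        rw [schedRHS_act hs (a := x.1) (P := x.2) hσ]
        have : quot (∅ : Set (List (Option A))) x.1 = ∅ := rfl
        simp [this]
    · rw [schedRHS_prob hs (by simp)]
      simp
  · simp [hΦ]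

end

/-! ### From schedulers to strategies -/

/-- Strategies may be given up wherever the scheduler still succeeds with probability one. At those
places the supremum of the bounds achieved by plays replaces the value of the scheduler; the result
is a pre-fixed point, so it dominates the least one, and the supremum is 1. -/
theorem AS.of_scheduler {s₀ : Proc A K} {C : Set (Proc A K)} {a : Option A}
    (σ : Scheduler D s₀) (h : schedProb D σ (weakTraces a) C = 1) : AS D C a s₀ := by
  classical
  let W : Option A → Proc A K → Prop := fun m t =>
    ∃ θ, lastState s₀ θ = t ∧ schedVal D σ C θ (weakTraces m) = 1
  let Y : Comp A K → Set (List (Option A)) → ℝ≥0∞ := fun θ Φ =>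
    if schedVal D σ C θ Φ = 1 ∧ ∃ m, Φ = weakTraces m then
      ⨆ (m : Option A) (_ : Φ = weakTraces m) (q : ℝ≥0∞)
        (_ : Play D C W m (lastState s₀ θ) q), q
    else schedVal D σ C θ Φ
  have hYle (θ Φ) : Y θ Φ ≤ schedVal D σ C θ Φ := by
    by_cases h : schedVal D σ C θ Φ = 1 ∧ ∃ m, Φ = weakTraces m
    · simp only [Y, if_pos h]
      rw [h.1]
      exact iSup_le fun m => iSup_le fun _ => iSup_le fun q => iSup_le fun hq => hq.le_one
    · simp only [Y, if_neg h, le_refl]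
  have hY {θ m q} (h : schedVal D σ C θ (weakTraces m) = 1)
      (hq : Play D C W m (lastState s₀ θ) q) : q ≤ Y θ (weakTraces m) := by
    simp only [Y, if_pos (⟨h, m, rfl⟩ : _ ∧ ∃ m', weakTraces m = weakTraces m')]
    exact le_iSup_of_le m (le_iSup_of_le rfl (le_iSup₂_of_le q hq le_rfl))
  have hplay {θ m c} (h : schedVal D σ C θ (weakTraces m) = 1) (hc : c < 1) :
      Play D C W m (lastState s₀ θ) (c * Y θ (weakTraces m)) := by
    -- The language determines `m`, so the supremum over `m` in `Y` has a single term.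
    have hinj {m' : Option A} (h : weakTraces m = weakTraces m') : m = m' := by
      cases m with
      | none =>
        have : [] ∈ weakTraces m' := by rw [← h]; exact nil_mem_weakTraces.2 rfl
        exact (nil_mem_weakTraces.1 this).symm
      | some a =>
        have : [some a] ∈ weakTraces m' := by rw [← h]; exact ⟨0, 0, rfl⟩
        cases m' with
        | none =>
          obtain ⟨n, hn⟩ := this
          cases n <;> simp [List.replicate_succ] at hn
        | some b =>
          obtain ⟨n, k, hn⟩ := this
          cases n with
          | zero => simp at hn; rw [hn.1]
          | succ n => simp [List.replicate_succ] at hn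
    have : Nonempty {q // Play D C W m (lastState s₀ θ) q} := ⟨⟨0, .defer ⟨θ, rfl, h⟩⟩⟩
    obtain ⟨⟨q, hq⟩, hi⟩ := exists_mul_iSup_le
      (fun i : {q // Play D C W m (lastState s₀ θ) q} => i.1) (fun i => i.2.le_one) hc
    refine .weaken hq (le_trans ?_ hi)
    gcongr
    simp only [Y, if_pos (⟨h, m, rfl⟩ : _ ∧ ∃ m', weakTraces m = weakTraces m')]
    exact iSup_le fun m' => iSup_le fun hm => iSup_le fun q => iSup_le fun hq' =>
      le_iSup (fun i : {q // Play D C W m (lastState s₀ θ) q} => i.1) ⟨q, by rwa [hinj hm]⟩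
  have hpre (θ Φ) : schedRHS D σ C Y θ Φ ≤ Y θ Φ := by
    by_cases hval : schedVal D σ C θ Φ = 1 ∧ ∃ m, Φ = weakTraces m
    swap
    · refine (schedRHS_mono D σ C hYle θ Φ).trans ?_
      rw [← schedVal_eq]
      simp only [Y, if_neg hval, le_refl]
    obtain ⟨hval, m, rfl⟩ := hval
    have hrhs := schedVal_eq.symm.trans hval
    by_cases hh : [] ∈ weakTraces m ∧ lastState s₀ θ ∈ C ∧ σ.next θ = none
    · rw [schedRHS_halt hh.1 hh.2.1 hh.2.2]
      obtain rfl := nil_mem_weakTraces.1 hh.1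
      exact hY hval (.halt hh.2.1)
    rcases hs : lastState s₀ θ with ⟨_ | _, E⟩
    · cases hσ : σ.next θ with
      | none =>
        rw [schedRHS_stop (fun h' => hh ⟨h'.1, h'.2, hσ⟩) hs hσ]
        exact zero_le
      | some x =>
        obtain ⟨a, P⟩ := x
        rw [schedRHS_act hs hσ] at hrhs ⊢
        obtain ⟨N, hN, hact⟩ := σ.valid θ a P hσ
        -- The supremum in `Y` need not be attained, so it is approached from below.
        refine ENNReal.le_of_forall_lt_one_mul_le fun c hc => ?_
        cases a with
        | none =>
          rw [quot_none] at hrhs ⊢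
          refine hY hval ?_
          rw [hN]
          exact .tau hact (hplay hrhs hc)
        | some a =>
          by_cases hma : m = some a
          · subst hma
            rw [quot_some_self] at hrhs ⊢
            refine hY hval ?_
            rw [hN]
            exact .vis hact (hplay hrhs hc)
          · rw [quot_some_of_ne hma, schedVal_empty] at hrhs
            exact absurd hrhs zero_ne_one
    · have hnh : ¬ ([] ∈ weakTraces m ∧ lastState s₀ θ ∈ C) :=
        fun h' => hh ⟨h'.1, h'.2, next_eq_none hs⟩
      rw [schedRHS_prob hs hnh] at hrhs ⊢
      -- Values are at most 1 and the weights are positive with sum 1, so an average of 1 forces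
      -- every successor to have value 1.
      have hone : ∀ t : PTransOf D E,
          schedVal D σ C ((.inr t.1, t.2.1.st) :: θ) (weakTraces m) = 1 := by
        intro t
        by_contra hne
        have e1 : ∑' t : PTransOf D E, (t.1 : ℝ≥0∞) *
            schedVal D σ C ((.inr t.1, t.2.1.st) :: θ) (weakTraces m) < ∑' t : PTransOf D E,
              (t.1 : ℝ≥0∞) * 1 := by
          refine ENNReal.tsum_lt_tsum (i := t) (by rw [hrhs]; simp)
            (fun t => mul_le_mul_right (schedVal_le_one _ _) _) ?_
          exact ENNReal.mul_lt_mul_right (by exact_mod_cast t.2.2.pos.ne') (by simp)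
            (lt_of_le_of_ne (schedVal_le_one _ _) hne)
        rw [hrhs] at e1
        exact absurd (ex_unit (D := D) E) (by rw [ex_pr]; exact e1.ne')
      -- Transitions to the same `N` with different labels give different computations, which the
      -- scheduler may continue differently. A play distinguishes outcomes only, hence the supremum
      -- over labels.
      let V : Term A K .nd → ℝ≥0∞ := fun N =>
        ⨆ p : {p : ℝ≥0 // Nonempty (PTrans D E p N)}, Y ((.inr p.1, N.st) :: θ) (weakTraces m)
      have hle : ∑' t : PTransOf D E, (t.1 : ℝ≥0∞) * Y ((.inr t.1, t.2.1.st) :: θ) (weakTraces m) ≤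
          ex D E V := by
        rw [ex_pr]
        refine ENNReal.tsum_le_tsum fun t => mul_le_mul_right ?_ _
        exact le_iSup (fun p : {p : ℝ≥0 // Nonempty (PTrans D E p t.2.1)} =>
          Y ((.inr p.1, t.2.1.st) :: θ) (weakTraces m)) ⟨t.1, ⟨t.2.2⟩⟩
      refine hle.trans (ENNReal.le_of_forall_lt_one_mul_le fun c hc => ?_)
      obtain ⟨d, hd, hcd⟩ := exists_lt_one_le_mul_self hc
      refine hY hval ?_
      rw [hs]
      refine .weaken (Play.resolve (fun N => d * d * V N) fun N hN => ?_)
        (by rw [ex_mul_left]; gcongr)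
      obtain ⟨p, hp⟩ := hN
      have : Nonempty {p : ℝ≥0 // Nonempty (PTrans D E p N)} := ⟨⟨p, hp⟩⟩
      obtain ⟨⟨p, ⟨t⟩⟩, hi⟩ := exists_mul_iSup_le
        (fun p : {p : ℝ≥0 // Nonempty (PTrans D E p N)} =>
          Y ((.inr p.1, N.st) :: θ) (weakTraces m))
        (fun p => (hYle _ _).trans (schedVal_le_one _ _)) hd
      refine .weaken (hplay (hone ⟨p, N, t⟩) hd) ?_
      rw [mul_assoc]
      gcongr
  refine ⟨W, ⟨[], rfl, h⟩, ?_⟩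
  rintro m t ⟨θ, rfl, hθ⟩
  have h1 : Y θ (weakTraces m) = 1 :=
    le_antisymm ((hYle _ _).trans (schedVal_le_one _ _)) (hθ.symm.le.trans (schedVal_le hpre _ _))
  simpa [h1] using hplay (c := 2⁻¹) hθ (by simp)

/-! ### From strategies to schedulers -/

/-- Strategies with memory. -/
inductive Strat (A : Type u) (K : Kind → Type v) : Type (max u v)
  | halt : Strat A K
  | defer : Strat A K
  | go (a : Option A) (P : Term A K .pr) (S : Strat A K) : Strat A K
  | flip (S : Term A K .nd → Strat A K) : Strat A K

/-- `Play` with an explicit strategy. -/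
inductive Follows (D : Equations A K) (C : Set (Proc A K)) (W : Option A → Proc A K → Prop) :
    Strat A K → Option A → Proc A K → ℝ≥0∞ → Prop
  | halt {s : Proc A K} : s ∈ C → Follows D C W .halt none s 1
  | defer {m : Option A} {s : Proc A K} : W m s → Follows D C W .defer m s 0
  | tau {m : Option A} {N : Term A K .nd} {P : Term A K .pr} {q : ℝ≥0∞} {S : Strat A K} :
      Act D N none P → Follows D C W S m P.st q → Follows D C W (.go none P S) m N.st q
  | vis {a : A} {N : Term A K .nd} {P : Term A K .pr} {q : ℝ≥0∞} {S : Strat A K} :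
      Act D N (some a) P → Follows D C W S none P.st q →
      Follows D C W (.go (some a) P S) (some a) N.st q
  | flip {m : Option A} {P : Term A K .pr} (q : Term A K .nd → ℝ≥0∞)
      (S : Term A K .nd → Strat A K) :
      (∀ N, Supp D P N → Follows D C W (S N) m N.st (q N)) →
      Follows D C W (.flip S) m P.st (ex D P q)

/-- Turns the mere existence of moves into data. Strategies have no counterpart of `weaken`, which
is why the bound becomes `q ≤ r`. -/
theorem Play.follows {C : Set (Proc A K)} {W : Option A → Proc A K → Prop} {m : Option A}
    {s : Proc A K} {q : ℝ≥0∞} (h : Play D C W m s q) :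
    ∃ S, ∃ r, q ≤ r ∧ Follows D C W S m s r := by
  induction h with
  | halt h => exact ⟨_, _, le_rfl, .halt h⟩
  | defer h => exact ⟨_, _, le_rfl, .defer h⟩
  | tau h _ ih =>
    obtain ⟨S, r, hr, hS⟩ := ih
    exact ⟨_, _, hr, .tau h hS⟩
  | vis h _ ih =>
    obtain ⟨S, r, hr, hS⟩ := ih
    exact ⟨_, _, hr, .vis h hS⟩
  | @flip m P q _ ih =>
    have : ∀ N, ∃ S r, Supp D P N → q N ≤ r ∧ Follows D C W S m N.st r := by
      intro N
      by_cases hN : Supp D P N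
      · obtain ⟨S, r, hr, hS⟩ := ih N hN
        exact ⟨S, r, fun _ => ⟨hr, hS⟩⟩
      · exact ⟨.halt, 0, fun h => absurd h hN⟩
    choose S r hS using this
    exact ⟨_, _, ex_mono P fun N hN => (hS N hN).1, .flip r S fun N hN => (hS N hN).2⟩
  | weaken _ h ih =>
    obtain ⟨S, r, hr, hS⟩ := ih
    exact ⟨S, r, h.trans hr, hS⟩

theorem Follows.play {C : Set (Proc A K)} {W : Option A → Proc A K → Prop} {m : Option A}
    {s : Proc A K} {q : ℝ≥0∞} {S : Strat A K} (h : Follows D C W S m s q) :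
    Play D C W m s q := by
  induction h with
  | halt h => exact .halt h
  | defer h => exact .defer h
  | tau h _ ih => exact .tau h ih
  | vis h _ ih => exact .vis h ih
  | flip q S _ ih => exact .flip q ih

/-- The strategy to be followed after a strategy has been given up is the fresh one. -/
def Strat.renew (pick : Option A → Proc A K → Strat A K) (m : Option A) (t : Proc A K) :
    Strat A K → Option A × Strat A K
  | .defer => (m, pick m t)
  | S => (m, S)

/-- The part of the trace to be performed and the strategy after a computation. -/
def memory (pick : Option A → Proc A K → Strat A K) (a : Option A) (s₀ : Proc A K) :
    Comp A K → Option A × Strat A K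
  | [] => (a, pick a s₀)
  | (l, t) :: θ =>
    match memory pick a s₀ θ, l, t with
    | (m, .go none _ S), _, t => S.renew pick m t
    | (_, .go (some _) _ S), _, t => S.renew pick none t
    | (m, .flip S), _, ⟨.nd, N⟩ => (S N).renew pick m N.st
    | x, _, _ => x

open Classical in
/-- The scheduler that follows strategies, starting a fresh one whenever one is given up. -/
noncomputable def memorySched (D : Equations A K) (pick : Option A → Proc A K → Strat A K)
    (a : Option A) (s₀ : Proc A K) : Scheduler D s₀ where
  next θ := match memory pick a s₀ θ with
    | (_, .go b P _) =>
      if ∃ N : Term A K .nd, lastState s₀ θ = N.st ∧ Act D N b P then some (b, P) else none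
    | _ => none
  valid θ b P h := by
    split at h
    · split_ifs at h with hc
      simp only [Option.some.injEq, Prod.mk.injEq] at h
      obtain ⟨rfl, rfl⟩ := h
      exact hc
    · simp at h

/-- Restart a strategy whenever one is given up, and let `v` be the least value at a restart. A
round succeeds with probability at least one half and is otherwise worth at least `v`, so `(1 - v) /
2 + v ≤ v` and `v = 1`. -/
theorem AS.scheduler {s₀ : Proc A K} {C : Set (Proc A K)} {a : Option A} (h : AS D C a s₀) :
    ∃ σ : Scheduler D s₀, schedProb D σ (weakTraces a) C = 1 := by
  classical
  obtain ⟨W, hs₀, hW⟩ := h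
  have : ∀ m t, ∃ S r, W m t → 2⁻¹ ≤ r ∧ Follows D C W S m t r := by
    intro m t
    by_cases ht : W m t
    · obtain ⟨S, r, hr, hS⟩ := (hW m t ht).follows
      exact ⟨S, r, fun _ => ⟨hr, hS⟩⟩
    · exact ⟨.halt, 0, fun h => absurd h ht⟩
  choose pick r hpick using this
  set σ := memorySched D pick a s₀ with hσ
  let v : ℝ≥0∞ := ⨅ (θ : Comp A K) (m : Option A)
    (_ : W m (lastState s₀ θ) ∧ memory pick a s₀ θ = (m, pick m (lastState s₀ θ))),
      schedVal D σ C θ (weakTraces m)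
  have hv {θ m} (h : W m (lastState s₀ θ))
      (h' : memory pick a s₀ θ = (m, pick m (lastState s₀ θ))) :
      v ≤ schedVal D σ C θ (weakTraces m) := iInf₂_le_of_le θ m (iInf_le _ ⟨h, h'⟩)
  have hv1 : v ≤ 1 := (hv (θ := []) hs₀ rfl).trans (schedVal_le_one _ _)
  have key {S m t q} (h : Follows D C W S m t q) : ∀ θ, lastState s₀ θ = t →
      memory pick a s₀ θ = S.renew pick m t →
      (1 - v) * q + v ≤ schedVal D σ C θ (weakTraces m) := by
    induction h with
    | halt hC =>
      rintro θ rfl hmem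
      rw [schedVal_eq, schedRHS_halt (nil_mem_weakTraces.2 rfl) hC, mul_one,
        tsub_add_cancel_of_le hv1]
      simp [hσ, memorySched, hmem, Strat.renew]
    | defer ht =>
      rintro θ rfl hmem
      simpa using hv ht hmem
    | @tau m N P q S hN _ ih =>
      intro θ hθ hmem
      have hnext : σ.next θ = some (none, P) := by
        simp only [hσ, memorySched, hmem, Strat.renew]
        exact if_pos ⟨N, hθ, hN⟩
      rw [schedVal_eq, schedRHS_act hθ hnext, quot_none]
      exact ih _ rfl (by simp [memory, hmem, Strat.renew])
    | @vis b N P q S hN _ ih =>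
      intro θ hθ hmem
      have hnext : σ.next θ = some (some b, P) := by
        simp only [hσ, memorySched, hmem, Strat.renew]
        exact if_pos ⟨N, hθ, hN⟩
      rw [schedVal_eq, schedRHS_act hθ hnext, quot_some_self]
      exact ih _ rfl (by simp [memory, hmem, Strat.renew])
    | @flip m P q S hS ih =>
      intro θ hθ hmem
      -- If the trace is complete and the state is in `C`, the equations stop with value 1 whatever
      -- the strategy intended.
      by_cases hc : [] ∈ weakTraces m ∧ lastState s₀ θ ∈ C
      · rw [schedVal_eq, schedRHS_halt hc.1 hc.2 (next_eq_none hθ)]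
        calc (1 - v) * ex D P q + v ≤ (1 - v) * 1 + v := by
              gcongr
              exact (Follows.flip q S hS).play.le_one
          _ = 1 := by rw [mul_one, tsub_add_cancel_of_le hv1]
      · rw [schedVal_eq, schedRHS_prob hθ hc]
        calc (1 - v) * ex D P q + v = ex D P fun N => (1 - v) * q N + v := by
              rw [ex_add, ex_mul_left, ex_fun_const]
          _ ≤ _ := by
              rw [ex_pr]
              refine ENNReal.tsum_le_tsum fun t => mul_le_mul_right ?_ _
              exact ih t.2.1 ⟨t.1, ⟨t.2.2⟩⟩ _ rfl (by simp [memory, hmem, Strat.renew])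
  have hhalf {θ m} (h : W m (lastState s₀ θ))
      (h' : memory pick a s₀ θ = (m, pick m (lastState s₀ θ))) :
      (1 - v) * 2⁻¹ + v ≤ schedVal D σ C θ (weakTraces m) := by
    obtain ⟨hr, hF⟩ := hpick _ _ h
    refine le_trans (by gcongr) (key hF θ rfl ?_)
    rw [h']
    -- A fresh strategy is never `defer`, whose success probability is 0, so `renew` leaves it
    -- unchanged.
    cases hp : pick m (lastState s₀ θ) with
    | defer =>
      rw [hp] at hF
      generalize r m (lastState s₀ θ) = x at hr hF
      cases hF
      simp at hr
    | _ => rfl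
  have hvv : (1 - v) * 2⁻¹ + v ≤ v := le_iInf fun θ => le_iInf fun m => le_iInf fun h => hhalf h.1 h.2
  have hv_eq : v = 1 := by
    have hvt : v ≠ ⊤ := (hv1.trans_lt ENNReal.one_lt_top).ne
    have h0 : (1 - v) * 2⁻¹ = 0 := by
      have : (1 - v) * 2⁻¹ + v ≤ 0 + v := by simpa using hvv
      simpa using (ENNReal.add_le_add_iff_right hvt).1 this
    have h1 : 1 - v = 0 := by simpa using h0
    exact le_antisymm hv1 (tsub_eq_zero_iff_le.1 h1)
  refine ⟨σ, le_antisymm (schedVal_le_one _ _) ?_⟩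
  calc (1 : ℝ≥0∞) = v := hv_eq.symm
    _ ≤ _ := hv (θ := []) hs₀ rfl

end PNI

namespace PNI

variable {A : Type u} {K : Kind → Type v} {D : Equations A K}

/-! ### Simulations -/

/-- `Ans D e C₀ C a s`: the state `s` can answer a transition labelled `a` from a state of `C₀`
to a state of `C` (where `C₀` matters for branching bisimilarity only). -/
def Ans (D : Equations A K) :
    BisimKind → Set (Proc A K) → Set (Proc A K) → Option A → Proc A K → Prop
  | .pw, _, C, a, s => AS D C a s
  | .pb, C₀, C, a, s => (a = none ∧ s ∈ C) ∨
      ∃ (N : Term A K .nd) (P : Term A K .pr),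
        Weak D s N.st ∧ Act D N a P ∧ N.st ∈ C₀ ∧ P.st ∈ C

theorem Ans.mono {e : BisimKind} {C₀ C₀' C C' : Set (Proc A K)} {a : Option A} {s : Proc A K}
    (h : Ans D e C₀ C a s) (h₀ : C₀ ⊆ C₀') (h₁ : C ⊆ C') : Ans D e C₀' C' a s := by
  cases e with
  | pw => exact AS.mono h h₁
  | pb =>
    rcases h with ⟨ha, hs⟩ | ⟨N, P, hw, hN, hN₀, hP⟩
    · exact .inl ⟨ha, h₁ hs⟩
    · exact .inr ⟨N, P, hw, hN, h₀ hN₀, h₁ hP⟩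

theorem Ans.halt {e : BisimKind} {C₀ C : Set (Proc A K)} {s : Proc A K} (h : s ∈ C) :
    Ans D e C₀ C none s := by
  cases e with
  | pw => exact AS.halt h
  | pb => exact .inl ⟨rfl, h⟩

theorem Ans.act {e : BisimKind} {C₀ C : Set (Proc A K)} {a : Option A} {N : Term A K .nd}
    {P : Term A K .pr} (h : Act D N a P) (hN : N.st ∈ C₀) (hP : P.st ∈ C) :
    Ans D e C₀ C a N.st := by
  cases e with
  | pw => exact AS.act h hP
  | pb => exact .inr ⟨N, P, .refl, h, hN, hP⟩

/-- Simulations with respect to the chosen equivalence. -/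
def Sim (D : Equations A K) (e : BisimKind) (R : Proc A K → Proc A K → Prop) : Prop :=
  (∀ s s', R s s' → Lift D R s s') ∧
  ∀ (N : Term A K .nd) (s' : Proc A K) (a : Option A) (P : Term A K .pr),
    R N.st s' → Act D N a P → Ans D e {t | R N.st t} {t | R P.st t} a s'

/-- Strong simulations up to a relabelling of the actions. -/
def StrongSim (D : Equations A K) (G : Option A → Option A → Prop)
    (R : Proc A K → Proc A K → Prop) : Prop :=
  (∀ s s', R s s' → Lift D R s s') ∧
  ∀ (N : Term A K .nd) (s' : Proc A K) (a a' : Option A) (P : Term A K .pr),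
    R N.st s' → Act D N a P → G a a' →
      ∃ (N' : Term A K .nd) (P' : Term A K .pr), s' = N'.st ∧ Act D N' a' P' ∧ R P.st P'.st

/-- `hG` lets silent moves be copied as silent moves, while `G` may still turn a visible action into
`τ`, as hiding does. -/
theorem StrongSim.ans {e : BisimKind} {G : Option A → Option A → Prop}
    {R : Proc A K → Proc A K → Prop} (hR : StrongSim D G R) (hG : ∀ a, G none a ↔ a = none)
    {C₀ C₀' C C' : Set (Proc A K)} {a a' : Option A} {s s' : Proc A K}
    (h : Ans D e C₀ C a s) (hs : R s s') (ha : G a a')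
    (h₀ : ∀ t t', t ∈ C₀ → R t t' → t' ∈ C₀') (h₁ : ∀ t t', t ∈ C → R t t' → t' ∈ C') :
    Ans D e C₀' C' a' s' := by
  cases e with
  | pw =>
    refine AS.transfer hG hR.1 ?_ h₁ h hs ha
    intro N s' a a' P hN hact ha
    obtain ⟨N', P', rfl, hact', hP⟩ := hR.2 N s' a a' P hN hact ha
    exact AS.act hact' hP
  | pb =>
    rcases h with ⟨rfl, h⟩ | ⟨N, P, hw, hN, hN₀, hP⟩
    · exact .inl ⟨(hG _).1 ha, h₁ _ _ h hs⟩
    have hweak : ∀ t, Weak D s t → ∃ t', Weak D s' t' ∧ R t t' := by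
      intro t ht
      induction ht with
      | refl => exact ⟨s', .refl, hs⟩
      | tail _ hstep ih =>
        obtain ⟨t', ht', hR'⟩ := ih
        cases hstep with
        | tau hact =>
          obtain ⟨N', P', rfl, hact', hP⟩ := hR.2 _ _ none none _ hR' hact ((hG _).2 rfl)
          exact ⟨_, ht'.tail (.tau hact'), hP⟩
        | prob hp =>
          obtain ⟨N', hN', hR''⟩ := (hR.1 _ _ hR').exists_right ⟨_, ⟨hp⟩⟩
          exact ⟨_, ht'.trans hN'.weak, hR''⟩
    obtain ⟨t', ht', hR'⟩ := hweak _ hw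
    obtain ⟨N', P', rfl, hact', hPP⟩ := hR.2 _ _ _ _ _ hR' hN ha
    exact .inr ⟨N', P', ht', hact', h₀ _ _ hN₀ hR', h₁ _ _ hP hPP⟩

/-- Answers are preserved by symmetric simulations inside an equivalence relation. -/
theorem Sim.ans {e : BisimKind} {R E : Proc A K → Proc A K → Prop} (hR : Sim D e R)
    (hE : Equivalence E) (hRE : ∀ s t, R s t → E s t) {u w s s' : Proc A K} {a : Option A}
    (h : Ans D e {t | E u t} {t | E w t} a s) (hs : R s s') (hu : E u s) :
    Ans D e {t | E u t} {t | E w t} a s' := by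
  cases e with
  | pw =>
    refine AS.transfer (G := Eq) (fun a => eq_comm) hR.1 ?_ ?_ h hs rfl
    · rintro N s' a _ P hN hact rfl
      exact hR.2 N s' a P hN hact
    · exact fun t t' ht htt' => hE.trans ht (hRE _ _ htt')
  | pb =>
    rcases h with ⟨rfl, h⟩ | ⟨N, P, hw, hN, hN₀, hP⟩
    · exact .inl ⟨rfl, hE.trans h (hRE _ _ hs)⟩
    have hweak : ∀ t, Weak D s t → ∃ t', Weak D s' t' ∧ R t t' := by
      intro t ht
      induction ht with
      | refl => exact ⟨s', .refl, hs⟩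
      | tail _ hstep ih =>
        obtain ⟨t', ht', hR'⟩ := ih
        cases hstep with
        | tau hact =>
          rcases hR.2 _ _ none _ hR' hact with ⟨-, h⟩ | ⟨N', P', hw', hact', -, hP'⟩
          · exact ⟨t', ht', h⟩
          · exact ⟨_, (ht'.trans hw').tail (.tau hact'), hP'⟩
        | prob hp =>
          obtain ⟨N', hN', hR''⟩ := (hR.1 _ _ hR').exists_right ⟨_, ⟨hp⟩⟩
          exact ⟨_, ht'.trans hN'.weak, hR''⟩
    obtain ⟨t', ht', hR'⟩ := hweak _ hw
    rcases hR.2 _ _ _ _ hR' hN with ⟨rfl, h⟩ | ⟨N', P', hw', hact', hN', hP'⟩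
    -- The final silent step is answered by staying in `t'`, which is thus equivalent to both its
    -- source and its target; the classes of `u` and `w` coincide, and `s'` belongs to them.
    · have hwu : E w u :=
        hE.trans (hE.trans hP (hRE _ _ h)) (hE.symm (hE.trans hN₀ (hRE _ _ hR')))
      exact .inl ⟨rfl, hE.trans hwu (hE.trans hu (hRE _ _ hs))⟩
    · exact .inr ⟨N', P', ht'.trans hw', hact', hE.trans hN₀ (hRE _ _ hN'),
        hE.trans hP (hRE _ _ hP')⟩

/-- The definition of the bisimulations in terms of simulations. -/
theorem bisimilar_iff_setoid {e : BisimKind} {s t : Proc A K} :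
    Bisimilar D e s t ↔ ∃ B : Setoid (Proc A K), Sim D e B ∧ B s t := by
  have hlift (B : Setoid (Proc A K)) : (∀ s₁ s₂ : Proc A K, B s₁ s₂ → ∀ C ∈ B.classes,
      probSet D s₁ C = probSet D s₂ C) ↔ ∀ s₁ s₂, B s₁ s₂ → Lift D B s₁ s₂ := by
    refine ⟨fun h s₁ s₂ hB => lift_of_probSet (h s₁ s₂ hB), fun h s₁ s₂ hB C hC => ?_⟩
    obtain ⟨x, rfl⟩ := hC
    exact le_antisymm
      (probSet_le_of_lift (h s₁ s₂ hB) fun t t' htt' ht => B.trans' (B.symm' htt') ht)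
      (probSet_le_of_lift (h s₂ s₁ (B.symm' hB)) fun t t' htt' ht => B.trans' (B.symm' htt') ht)
  cases e with
  | pw =>
    refine exists_congr fun B => and_congr_left fun _ => ?_
    have hset (P : Term A K .pr) : {t : Proc A K | B t P.st} = {t | B P.st t} :=
      Set.ext fun t => ⟨B.symm', B.symm'⟩
    constructor
    · intro h
      refine ⟨(hlift B).1 h.prob, fun N s' a P hN hact => ?_⟩
      obtain ⟨σ, hσ⟩ := h.act N s' hN a P hact
      rw [hset] at hσ
      exact AS.of_scheduler σ hσ
    · intro h
      refine ⟨fun N s' hN a P hact => ?_, (hlift B).2 h.1⟩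
      rw [hset]
      exact AS.scheduler (h.2 N s' a P hN hact)
  | pb =>
    refine exists_congr fun B => and_congr_left fun _ => ?_
    exact ⟨fun h => ⟨(hlift B).1 h.prob, fun N s' a P hN hact => h.act N s' hN a P hact⟩,
      fun h => ⟨fun N s' hN a P hact => h.2 N s' a P hN hact, (hlift B).2 h.1⟩⟩

theorem Sim.union {e : BisimKind} {R R' : Proc A K → Proc A K → Prop} (h : Sim D e R)
    (h' : Sim D e R') : Sim D e fun s t => R s t ∨ R' s t := by
  constructor
  · rintro s s' (hs | hs)
    · exact (h.1 _ _ hs).mono fun _ _ => .inl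
    · exact (h'.1 _ _ hs).mono fun _ _ => .inr
  · rintro N s' a P (hN | hN) hact
    · exact (h.2 _ _ _ _ hN hact).mono (fun _ => .inl) fun _ => .inl
    · exact (h'.2 _ _ _ _ hN hact).mono (fun _ => .inr) fun _ => .inr

/-- The reflexive transitive closure is an equivalence, and an answer is carried along a chain one
link at a time by `Sim.ans`. -/
theorem Sim.bisimilar_of_symm {e : BisimKind} {R : Proc A K → Proc A K → Prop} (h : Sim D e R)
    (hsymm : ∀ s t, R s t → R t s) {s t : Proc A K}
    (hst : Relation.ReflTransGen R s t) : Bisimilar D e s t := by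
  let E := Relation.ReflTransGen R
  have : Std.Symm R := ⟨hsymm⟩
  have hE : Equivalence E :=
    ⟨fun _ => .refl, Relation.ReflTransGen.stdSymm.symm _ _, fun h h' => h.trans h'⟩
  refine bisimilar_iff_setoid.2 ⟨⟨E, hE⟩, ⟨fun s s' hs => ?_, fun N s' a P hN hact => ?_⟩, hst⟩
  · change Lift D E s s'
    replace hs : Relation.ReflTransGen R s s' := hs
    induction hs with
    | refl => exact Lift.refl hE.refl _
    | tail _ h' ih => exact (ih.comp (h.1 _ _ h')).mono fun s s'' ⟨t, ht, ht'⟩ => ht.tail ht'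
  · change Ans D e {t | E N.st t} {t | E P.st t} a s'
    replace hN : Relation.ReflTransGen R N.st s' := hN
    induction hN with
    | refl => exact .act hact .refl .refl
    | tail hx hy ih => exact h.ans hE (fun _ _ => .single) ih hy hx

/-- Processes related by a relation which, like its converse, is a simulation are bisimilar. -/
theorem Sim.bisimilar {e : BisimKind} {R : Proc A K → Proc A K → Prop} (h : Sim D e R)
    (h' : Sim D e fun s t => R t s) {s t : Proc A K} (hst : R s t) : Bisimilar D e s t :=
  (h.union h').bisimilar_of_symm (fun _ _ => Or.symm) (.single (.inl hst))

theorem bisimilar_sim (e : BisimKind) : Sim D e (Bisimilar D e) := by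
  constructor
  · intro s s' h
    obtain ⟨B, hB, hs⟩ := bisimilar_iff_setoid.1 h
    exact (hB.1 _ _ hs).mono fun _ _ h => bisimilar_iff_setoid.2 ⟨B, hB, h⟩
  · intro N s' a P h hact
    obtain ⟨B, hB, hs⟩ := bisimilar_iff_setoid.1 h
    exact (hB.2 _ _ _ _ hs hact).mono (fun _ h => bisimilar_iff_setoid.2 ⟨B, hB, h⟩)
      fun _ h => bisimilar_iff_setoid.2 ⟨B, hB, h⟩

theorem Bisimilar.symm {e : BisimKind} {s t : Proc A K} (h : Bisimilar D e s t) :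
    Bisimilar D e t s := by
  obtain ⟨B, hB, hs⟩ := bisimilar_iff_setoid.1 h
  exact bisimilar_iff_setoid.2 ⟨B, hB, B.symm' hs⟩

/-- A union of equivalence relations need not be transitive; its closure is again a bisimulation,
hence contained in bisimilarity. -/
theorem bisimilar_equivalence (e : BisimKind) : Equivalence (Bisimilar D e) where
  refl _ := (bisimilar_sim e).bisimilar_of_symm (fun _ _ => .symm) .refl
  symm := .symm
  trans h h' := (bisimilar_sim e).bisimilar_of_symm (fun _ _ => .symm) (.tail (.single h) h')

theorem Bisimilar.refl {e : BisimKind} (s : Proc A K) : Bisimilar D e s s :=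
  (bisimilar_equivalence e).refl s

theorem Bisimilar.trans {e : BisimKind} {s t r : Proc A K} (h : Bisimilar D e s t)
    (h' : Bisimilar D e t r) : Bisimilar D e s r := (bisimilar_equivalence e).trans h h'

theorem Bisimilar.lift {e : BisimKind} {s t : Proc A K} (h : Bisimilar D e s t) :
    Lift D (Bisimilar D e) s t := (bisimilar_sim e).1 s t h

theorem Bisimilar.ans_act {e : BisimKind} {N : Term A K .nd} {s : Proc A K}
    (h : Bisimilar D e N.st s) {a : Option A} {P : Term A K .pr} (hact : Act D N a P) :
    Ans D e {t | Bisimilar D e N.st t} {t | Bisimilar D e P.st t} a s :=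
  (bisimilar_sim e).2 N s a P h hact

theorem Bisimilar.ans {e : BisimKind} {u w s s' : Proc A K} {a : Option A}
    (hs : Bisimilar D e s s') (hu : Bisimilar D e u s)
    (h : Ans D e {t | Bisimilar D e u t} {t | Bisimilar D e w t} a s) :
    Ans D e {t | Bisimilar D e u t} {t | Bisimilar D e w t} a s' :=
  (bisimilar_sim e).ans (bisimilar_equivalence e) (fun _ _ h => h) h hs hu

theorem Bisimilar.class_eq {e : BisimKind} {s t : Proc A K} (h : Bisimilar D e s t) :
    {r | Bisimilar D e s r} = {r | Bisimilar D e t r} :=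
  Set.ext fun _ => ⟨h.symm.trans, h.trans⟩

/-- Composition of bisimilarity with a strong simulation. -/
theorem StrongSim.sim_comp {e : BisimKind} {R : Proc A K → Proc A K → Prop}
    (hR : StrongSim D Eq R) :
    Sim D e fun s s' => ∃ t, Bisimilar D e s t ∧ R t s' := by
  constructor
  · rintro s s' ⟨t, hst, hts'⟩
    exact hst.lift.comp (hR.1 _ _ hts')
  · rintro N s' a P ⟨t, hst, hts'⟩ hact
    exact hR.ans (fun _ => eq_comm) (hst.ans_act hact) hts' rfl (fun r r' hr hr' => ⟨r, hr, hr'⟩)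
      fun r r' hr hr' => ⟨r, hr, hr'⟩

/-- Needed because an asynchronous move of one parallel component wraps the idle one in `[1]`. -/
theorem one_res_bisimilar {e : BisimKind} (N : Term A K .nd) (H : Set A) :
    Bisimilar D e ((one N).res H).st (N.res H).st := by
  let R : Proc A K → Proc A K → Prop := fun s t =>
    s = t ∨ (s = ((one N).res H).st ∧ t = (N.res H).st)
  refine Sim.bisimilar (R := R) ⟨?_, ?_⟩ ⟨?_, ?_⟩ (.inr ⟨rfl, rfl⟩)
  · rintro s t (rfl | ⟨rfl, rfl⟩)
    · exact Lift.refl (fun _ => .inl rfl) _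
    · intro f g hfg
      have h1 (f : Term A K .nd → ℝ≥0∞) : ex D ((one N).res H) f = f (N.res H) := by
        rw [ex_res, ex_one]
      exact (h1 f).trans_le (hfg _ _ (.inl rfl))
  · rintro M t a P (rfl | ⟨h, rfl⟩) hact
    · exact .act hact (.inl rfl) (.inl rfl)
    · simp at h
  · rintro s t (rfl | ⟨rfl, rfl⟩)
    · exact Lift.refl (fun _ => .inl rfl) _
    · intro f g hfg
      have h1 (f : Term A K .nd → ℝ≥0∞) : ex D ((one N).res H) f = f (N.res H) := by
        rw [ex_res, ex_one]
      exact (hfg _ _ (.inl rfl)).trans_eq (h1 g).symm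
  · rintro M t a P (rfl | ⟨rfl, h⟩) hact
    · exact .act hact (.inl rfl) (.inl rfl)
    · obtain rfl : M = N.res H := by simpa using h
      have hs : Supp D ((one N).res H) (N.res H) := supp_res.2 ⟨N, supp_one.2 rfl, rfl⟩
      cases e with
      | pw =>
        refine AS.resolve fun M hM => ?_
        obtain ⟨M', hM', rfl⟩ := supp_res.1 hM
        obtain rfl := supp_one.1 hM'
        exact AS.act hact (.inl rfl)
      | pb => exact .inr ⟨_, P, hs.weak, hact, .inl rfl, .inl rfl⟩

end PNI

namespace PNI

variable {A : Type u} {K : Kind → Type v} {D : Equations A K}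

/-! ### Transitions of compound processes -/

theorem act_res {N : Term A K .nd} {L : Set A} {a : Option A} {Q : Term A K .pr} :
    Act D (N.res L) a Q ↔ ∃ P, Q = P.res L ∧ Act D N a P ∧ a ∉ some '' L := by
  constructor
  · intro h
    cases h with
    | res h ha => exact ⟨_, rfl, h, ha⟩
  · rintro ⟨P, rfl, h, ha⟩
    exact .res h ha

theorem act_hide {N : Term A K .nd} {L : Set A} {a : Option A} {Q : Term A K .pr} :
    Act D (N.hide L) a Q ↔ ∃ P b, Q = P.hide L ∧ Act D N b P ∧
      ((b ∈ some '' L ∧ a = none) ∨ (b ∉ some '' L ∧ a = b)) := by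
  constructor
  · intro h
    cases h with
    | hideIn h hb => exact ⟨_, _, rfl, h, .inl ⟨hb, rfl⟩⟩
    | hideOut h hb => exact ⟨_, _, rfl, h, .inr ⟨hb, rfl⟩⟩
  · rintro ⟨P, b, rfl, h, ⟨hb, rfl⟩ | ⟨hb, rfl⟩⟩
    · exact .hideIn h hb
    · exact .hideOut h hb

theorem act_par {N₁ N₂ : Term A K .nd} {L : Set A} {a : Option A} {Q : Term A K .pr} :
    Act D (.par L N₁ N₂) a Q ↔
      (∃ P₁, Q = .par L P₁ (one N₂) ∧ Act D N₁ a P₁ ∧ a ∉ some '' L) ∨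
      (∃ P₂, Q = .par L (one N₁) P₂ ∧ Act D N₂ a P₂ ∧ a ∉ some '' L) ∨
      (∃ P₁ P₂, Q = .par L P₁ P₂ ∧ Act D N₁ a P₁ ∧ Act D N₂ a P₂ ∧ a ∈ some '' L) := by
  constructor
  · intro h
    cases h with
    | parLeft h ha => exact .inl ⟨_, rfl, h, ha⟩
    | parRight h ha => exact .inr (.inl ⟨_, rfl, h, ha⟩)
    | synch h h' ha => exact .inr (.inr ⟨_, _, rfl, h, h', ha⟩)
  · rintro (⟨P, rfl, h, ha⟩ | ⟨P, rfl, h, ha⟩ | ⟨P, P', rfl, h, h', ha⟩)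
    · exact .parLeft h ha
    · exact .parRight h ha
    · exact .synch h h' ha

theorem Step.kind_cases {s t : Proc A K} (h : Step D s t) :
    (∃ (N : Term A K .nd) (a : Option A) (P : Term A K .pr),
      s = N.st ∧ t = P.st ∧ Act D N a P) ∨
    ∃ (P : Term A K .pr) (N : Term A K .nd), s = P.st ∧ t = N.st ∧ Supp D P N := by
  cases h with
  | act h => exact .inl ⟨_, _, _, rfl, rfl, h⟩
  | prob h => exact .inr ⟨_, _, rfl, rfl, _, ⟨h⟩⟩

theorem Reach.self (s : Proc A K) : Reach D s s := .comp .refl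

/-- `[1] N` need not be reached by transitions itself, but its only successor `N` is. -/
theorem Reach.steps {s t r : Proc A K} (h : Reach D s t)
    (h' : Relation.ReflTransGen (Step D) t r) : Reach D s r := by
  cases h with
  | comp h => exact .comp (h.trans h')
  | @one N h =>
    rcases Relation.ReflTransGen.cases_head h' with rfl | ⟨x, hx, h'⟩
    · exact .one h
    · rcases hx.kind_cases with ⟨M, a, P, hM, -⟩ | ⟨P, M, hP, rfl, hS⟩
      · simp at hM
      · obtain rfl : PNI.one N = P := by simpa using hP
        rw [supp_one.1 hS] at h'
        exact .comp (h.trans h')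

theorem Reach.act {s : Proc A K} {N : Term A K .nd} (h : Reach D s N.st) {a : Option A}
    {P : Term A K .pr} (hact : Act D N a P) : Reach D s P.st := h.steps (.single (.act hact))

theorem Reach.supp {s : Proc A K} {k : Kind} {E : Term A K k} (h : Reach D s E.st)
    {N : Term A K .nd} (hN : Supp D E N) : Reach D s N.st := h.steps hN.step

theorem Reach.steps_nd {s : Proc A K} {N : Term A K .nd} (h : Reach D s N.st) :
    Relation.ReflTransGen (Step D) s N.st := by
  cases h with
  | comp h => exact h

theorem Reach.trans_nd {s t : Proc A K} {N : Term A K .nd} (h : Reach D s t)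
    (h' : Reach D t N.st) : Reach D s N.st := h.steps h'.steps_nd

theorem Reach.toOne {s : Proc A K} {N : Term A K .nd} (h : Reach D s N.st) :
    Reach D s (PNI.one N).st := .one h.steps_nd

/-- Restricted to nondeterministic targets: an invariant of transitions says nothing about the
additional processes `[1] N`. -/
theorem Reach.invariant {I : ∀ {k : Kind}, Term A K k → Prop}
    (hact : ∀ (N : Term A K .nd) (a : Option A) (P : Term A K .pr), I N → Act D N a P → I P)
    (hsupp : ∀ (P : Term A K .pr) (N : Term A K .nd), I P → Supp D P N → I N)
    {k : Kind} {E : Term A K k} {N : Term A K .nd} (hE : I E) (h : Reach D E.st N.st) : I N := by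
  have key : ∀ t : Proc A K, Relation.ReflTransGen (Step D) E.st t → I t.2 := by
    intro t ht
    induction ht with
    | refl => exact hE
    | tail _ hstep ih =>
      rcases hstep.kind_cases with ⟨M, b, Q, rfl, rfl, hQ⟩ | ⟨Q, M, rfl, rfl, hM⟩
      · exact hact _ _ _ ih hQ
      · exact hsupp _ _ ih hM
  exact key _ h.steps_nd

theorem ActionsIn.of_reach {H : Set A} {s t : Proc A K} (h : ActionsIn D H s)
    (ht : Reach D s t) : ActionsIn D H t :=
  fun N a P hN hact => h N a P (ht.trans_nd hN) hact

theorem lift_res {R : Proc A K → Proc A K → Prop} {H H' : Set A} {k k' : Kind} {X : Term A K k}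
    {Y : Term A K k'} (h : Lift D R (X.res H).st (Y.res H').st) {f g : Term A K .nd → ℝ≥0∞}
    (hfg : ∀ N M : Term A K .nd, R (N.res H).st (M.res H').st → f N ≤ g M) :
    ex D X f ≤ ex D Y g := by
  -- Outside the terms restricted by `H` the supremum is 0, and outside those restricted by `H'` the
  -- infimum is `⊤`, so only pairs of restricted terms impose a condition.
  have h1 := h (fun Z => ⨆ (N : Term A K .nd) (_ : Z = N.res H), f N)
    (fun Z => ⨅ (M : Term A K .nd) (_ : Z = M.res H'), g M) (by
      intro Z Z' hZ
      refine iSup₂_le fun N hN => le_iInf₂ fun M hM => hfg N M ?_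
      rw [← hN, ← hM]
      exact hZ)
  simpa only [ex_res, Term.res.injEq, and_true, iSup_iSup_eq_right, iInf_iInf_eq_right] using h1

/-! ### The local condition behind the noninterference properties -/

/-- What a high-level transition between processes with low-level views `s` and `t` has to
satisfy. -/
def Matches (D : Equations A K) (e : BisimKind) : Property → Proc A K → Proc A K → Prop
  | .SBNDC, s, t => Bisimilar D e s t
  | _, s, t => Ans D e {r | Bisimilar D e s r} {r | Bisimilar D e t r} none s

/-- Every reachable high-level transition is matched in the low-level view. -/
def LocallySecure (D : Equations A K) (H : Set A) (e : BisimKind) (prop : Property) {k : Kind}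
    (E : Term A K k) : Prop :=
  ∀ (N : Term A K .nd) (P : Term A K .pr) (h : A), h ∈ H → Reach D E.st N.st →
    Act D N (some h) P → Matches D e prop (N.res H).st (P.res H).st

variable {H : Set A} {e : BisimKind} {prop : Property}

theorem not_mem_of_eq {a : Option A} {L : Set A} (h : a = none) : a ∉ some '' L := by
  rintro ⟨x, -, hx⟩
  rw [h] at hx
  simp at hx

/-- A process that does what the low-level view of another process does and, in addition,
internal moves corresponding to matched high-level transitions is bisimilar to that view. -/
theorem bisimilar_of_interference (V : ∀ {k : Kind}, Term A K k → Term A K k → Prop)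
    (hlift : ∀ {k : Kind} (E E' : Term A K k), V E E' → ∀ f g : Term A K .nd → ℝ≥0∞,
      (∀ N N' : Term A K .nd, V N N' → f N ≤ g N') → ex D E f ≤ ex D E' g)
    (hlift' : ∀ {k : Kind} (E E' : Term A K k), V E E' → ∀ f g : Term A K .nd → ℝ≥0∞,
      (∀ N N' : Term A K .nd, V N N' → g N' ≤ f N) → ex D E' g ≤ ex D E f)
    (hfwd : ∀ (N N' : Term A K .nd) (a : Option A) (P : Term A K .pr), V N N' → Act D N a P →
      a ∉ some '' H → ∃ P', Act D N' a P' ∧ V P P')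
    (hbwd : ∀ (N N' : Term A K .nd) (a : Option A) (P' : Term A K .pr), V N N' →
      Act D N' a P' → ∃ P, V P P' ∧ ((Act D N a P ∧ a ∉ some '' H) ∨ (a = none ∧
        Ans D e {r | Bisimilar D e (N.res H).st r} {r | Bisimilar D e (P.res H).st r} none
          (N.res H).st)))
    {k : Kind} {E E' : Term A K k} (hV : V E E') : Bisimilar D e (E.res H).st E'.st := by
  let R : Proc A K → Proc A K → Prop := fun s t =>
    ∃ (k : Kind) (E E' : Term A K k), s = (E.res H).st ∧ t = E'.st ∧ V E E'
  have hR : StrongSim D Eq R := by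
    constructor
    · rintro s s' ⟨k, E, E', rfl, rfl, hV⟩ f g hfg
      rw [ex_res]
      exact hlift E E' hV _ _ fun N N' hN => hfg _ _ ⟨_, N, N', rfl, rfl, hN⟩
    · rintro M s' a _ P ⟨k, E, E', hM, rfl, hV⟩ hact rfl
      cases k with
      | pr => simp at hM
      | nd =>
        obtain rfl : M = E.res H := by simpa using hM
        obtain ⟨P, rfl, hP, ha⟩ := act_res.1 hact
        obtain ⟨P', hP', hV'⟩ := hfwd _ _ _ _ hV hP ha
        exact ⟨E', P', rfl, hP', _, P, P', rfl, rfl, hV'⟩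
  -- Answers land in the right place only up to bisimilarity, so `R` is composed with bisimilarity
  -- on the left. Forwards `R` is a strong simulation; backwards a move is a low-level one or a
  -- silent one matched by `hans`.
  refine Sim.bisimilar hR.sim_comp ⟨?_, ?_⟩ ⟨_, .refl _, k, E, E', rfl, rfl, hV⟩
  · rintro s' s ⟨t, hst, k, E, E', rfl, rfl, hV⟩
    have h1 : Lift D (fun s t => R t s) E'.st (E.res H).st := by
      intro g f hfg
      rw [ex_res]
      exact hlift' E E' hV _ _ fun N N' hN => hfg _ _ ⟨_, N, N', rfl, rfl, hN⟩
    exact (h1.comp hst.symm.lift).mono fun x z ⟨y, hxy, hyz⟩ => ⟨y, hyz.symm, hxy⟩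
  · rintro M s a P' ⟨t, hst, k, E, E', rfl, hM, hV⟩ hact
    cases k with
    | pr => simp at hM
    | nd =>
      obtain rfl : M = E' := by simpa using hM
      obtain ⟨P, hV', ⟨hP, ha⟩ | ⟨rfl, hans⟩⟩ := hbwd _ _ _ _ hV hact
      · refine (hst.symm.ans_act (.res hP ha)).mono (fun r hr => ?_) fun r hr => ?_
        · exact ⟨_, Bisimilar.symm hr, _, _, _, rfl, rfl, hV⟩
        · exact ⟨_, Bisimilar.symm hr, _, _, _, rfl, rfl, hV'⟩
      · refine (hst.symm.ans (.refl _) hans).mono (fun r hr => ?_) fun r hr => ?_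
        · exact ⟨_, Bisimilar.symm hr, _, _, _, rfl, rfl, hV⟩
        · exact ⟨_, Bisimilar.symm hr, _, _, _, rfl, rfl, hV'⟩

/-- The high-level transition is a `τ`-transition of `N / H`, which `N \ H` has to answer; both
hidden processes are in the classes of the views. -/
theorem LocallySecure.of_SBSNNI {k : Kind} {E : Term A K k} (h : Secure D H e .SBSNNI E) :
    LocallySecure D H e .SBSNNI E := by
  intro N P x hx hN hact
  have h1 : Bisimilar D e (N.res H).st (N.hide H).st := h _ N hN
  have h2 : Bisimilar D e (P.res H).st (P.hide H).st := h _ P (hN.act hact)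
  have h3 := Bisimilar.ans_act h1.symm (.hideIn hact ⟨x, hx, rfl⟩)
  rwa [← h1.class_eq, ← h2.class_eq] at h3

/-- The tester `x . 0` with synchronization set `{x}` turns the transition into a silent one;
afterwards the harmless tester `[1] 0` remains. -/
theorem LocallySecure.of_P_BNDC {k : Kind} {E : Term A K k} (h : Secure D H e .P_BNDC E) :
    LocallySecure D H e .P_BNDC E := by
  intro N P x hx hN hact
  let F : Term A K .nd := .pre (some x) (one .nil)
  have hF : ActionsIn D H F.st := by
    intro M a Q hM hQ
    -- The tester only passes through itself, `[1] 0` and `0`.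
    have hI := Reach.invariant (I := fun {k} X => X.st = F.st ∨ X.st = (one .nil).st ∨
      X.st = (.nil : Term A K .nd).st) ?_ ?_ (.inl rfl) hM
    · rcases hI with hI | hI | hI
      · obtain rfl : M = .pre (some x) (one .nil) := by simpa using hI
        cases hQ
        exact ⟨x, hx, rfl⟩
      · simp at hI
      · obtain rfl : M = .nil := by simpa using hI
        cases hQ
    · rintro M a Q (hI | hI | hI) hQ
      · obtain rfl : M = .pre (some x) (one .nil) := by simpa using hI
        cases hQ
        exact .inr (.inl rfl)
      · simp at hI
      · obtain rfl : M = .nil := by simpa using hI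
        cases hQ
    · rintro Q M (hI | hI | hI) hM
      · simp at hI
      · obtain rfl : Q = one .nil := by simpa using hI
        exact .inr (.inr (by rw [supp_one.1 hM]))
      · simp at hI
  have hnil : ActionsIn D H (one (.nil : Term A K .nd)).st :=
    hF.of_reach ((Reach.self _).act (.pre _ _))
  have h1 := h _ N hN F hF {x} (by simpa using hx)
  have h2 := h _ P (hN.act hact) (one .nil) hnil {x} (by simpa using hx)
  have h3 := Bisimilar.ans_act h1.symm
    (.res (.hideIn (.synch hact (.pre (some x) _) ⟨x, rfl, rfl⟩) ⟨x, rfl, rfl⟩)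
      (not_mem_of_eq rfl))
  rwa [← h1.class_eq, ← h2.class_eq] at h3

theorem LocallySecure.to_SBSNNI {k : Kind} {E : Term A K k}
    (h : LocallySecure D H e .SBSNNI E) : Secure D H e .SBSNNI E := by
  intro k' E' hE'
  refine bisimilar_of_interference (fun {k} X X' => Reach D E.st X.st ∧ X' = X.hide H)
    ?_ ?_ ?_ ?_ ⟨hE', rfl⟩
  · rintro k X _ ⟨hX, rfl⟩ f g hfg
    rw [ex_hide]
    exact ex_mono _ fun N hN => hfg _ _ ⟨hX.supp hN, rfl⟩
  · rintro k X _ ⟨hX, rfl⟩ f g hfg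
    rw [ex_hide]
    exact ex_mono _ fun N hN => hfg _ _ ⟨hX.supp hN, rfl⟩
  · rintro N _ a P ⟨hN, rfl⟩ hact ha
    exact ⟨_, .hideOut hact ha, hN.act hact, rfl⟩
  · rintro N _ a Q ⟨hN, rfl⟩ hact
    obtain ⟨P, b, rfl, hP, ⟨⟨x, hx, rfl⟩, rfl⟩ | ⟨hb, rfl⟩⟩ := act_hide.1 hact
    · exact ⟨P, ⟨hN.act hP, rfl⟩, .inr ⟨rfl, h N P x hx hN hP⟩⟩
    · exact ⟨P, ⟨hN.act hP, rfl⟩, .inl ⟨hP, hb⟩⟩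

/-- The tester is existentially quantified in the relation because it changes along the way. Its own
moves are high and unsynchronized, hence blocked by the restriction; its synchronizations become
silent moves, matched by the local condition. -/
theorem LocallySecure.to_P_BNDC {k : Kind} {E : Term A K k}
    (h : LocallySecure D H e .P_BNDC E) : Secure D H e .P_BNDC E := by
  intro k' E' hE' F hF L hL
  refine bisimilar_of_interference (fun {k} X X' => Reach D E.st X.st ∧
    ∃ F : Term A K k, ActionsIn D H F.st ∧ X' = ((Term.par L X F).hide L).res H)
    ?_ ?_ ?_ ?_ ⟨hE', F, hF, rfl⟩
  · rintro k X _ ⟨hX, F, hF, rfl⟩ f g hfg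
    rw [ex_res, ex_hide, ex_par]
    refine ex_mono _ fun N hN => ?_
    rw [← ex_fun_const (D := D) F (f N)]
    exact ex_mono _ fun M hM => hfg _ _ ⟨hX.supp hN, M, hF.of_reach ((Reach.self _).supp hM), rfl⟩
  · rintro k X _ ⟨hX, F, hF, rfl⟩ f g hfg
    rw [ex_res, ex_hide, ex_par]
    refine ex_mono _ fun N hN => ?_
    rw [← ex_fun_const (D := D) F (f N)]
    exact ex_mono _ fun M hM => hfg _ _ ⟨hX.supp hN, M, hF.of_reach ((Reach.self _).supp hM), rfl⟩
  · rintro N _ a P ⟨hN, F, hF, rfl⟩ hact ha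
    have haL : a ∉ some '' L := fun hmem => ha (Set.image_mono hL hmem)
    exact ⟨_, .res (.hideOut (.parLeft hact haL) haL) ha, hN.act hact, one F,
      hF.of_reach (Reach.self _).toOne, rfl⟩
  · rintro N _ a Q ⟨hN, F, hF, rfl⟩ hact
    obtain ⟨Q, rfl, hQ, ha⟩ := act_res.1 hact
    obtain ⟨Q, b, rfl, hQ, hb⟩ := act_hide.1 hQ
    rcases act_par.1 hQ with ⟨P, rfl, hP, hbL⟩ | ⟨P, rfl, hP, hbL⟩ | ⟨P, F', rfl, hP, hF', hbL⟩
    · obtain ⟨-, rfl⟩ := hb.resolve_left fun h => hbL h.1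
      exact ⟨P, ⟨hN.act hP, one F, hF.of_reach (Reach.self _).toOne, rfl⟩, .inl ⟨hP, ha⟩⟩
    · obtain ⟨-, rfl⟩ := hb.resolve_left fun h => hbL h.1
      exact absurd (hF _ _ _ (Reach.self _) hP) ha
    · obtain ⟨-, rfl⟩ := hb.resolve_right fun h => h.1 hbL
      obtain ⟨x, hx, rfl⟩ := hbL
      exact ⟨P, ⟨hN.act hP, F', hF.of_reach ((Reach.self _).act hF'), rfl⟩,
        .inr ⟨rfl, h N P x (hL hx) hN hP⟩⟩

/-- The noninterference properties amount to the local condition. -/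
theorem secure_iff {k : Kind} {E : Term A K k} :
    Secure D H e prop E ↔ LocallySecure D H e prop E := by
  cases prop with
  | SBSNNI => exact ⟨.of_SBSNNI, LocallySecure.to_SBSNNI⟩
  | P_BNDC => exact ⟨.of_P_BNDC, LocallySecure.to_P_BNDC⟩
  | SBNDC =>
    exact ⟨fun h N P x hx hN hact => h N P x hx hN (hN.act hact) hact,
      fun h N P x hx hN _ hact => h N P x hx hN hact⟩

theorem LocallySecure.of_reach {k k' : Kind} {E : Term A K k} {E' : Term A K k'}
    (h : LocallySecure D H e prop E) (hE' : Reach D E.st E'.st) : LocallySecure D H e prop E' :=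
  fun N P x hx hN hact => h N P x hx (hE'.trans_nd hN) hact

/-! ### Prefix -/

theorem LocallySecure.pre {a : Option A} {E : Term A K .pr} (ha : a ∉ some '' H)
    (h : LocallySecure D H e prop E) : LocallySecure D H e prop (.pre a E) := by
  intro N P x hx hN hact
  rcases Relation.ReflTransGen.cases_head hN.steps_nd with hN' | ⟨t, ht, hN'⟩
  · obtain rfl : Term.pre a E = N := by simpa using hN'
    cases hact
    exact absurd ⟨x, hx, rfl⟩ ha
  · rcases ht.kind_cases with ⟨M, b, Q, hM, rfl, hQ⟩ | ⟨Q, M, hQ, -⟩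
    · obtain rfl : Term.pre a E = M := by simpa using hM
      cases hQ
      exact h N P x hx (.comp hN') hact
    · simp at hQ

/-! ### Restriction and hiding -/

/-- Unary operators that act on low-level transitions by the relabelling `G`. -/
structure IsLowContext (D : Equations A K) (H : Set A) (G : Option A → Option A → Prop)
    (op : ∀ {k : Kind}, Term A K k → Term A K k) : Prop where
  relabel_none : ∀ a, G none a ↔ a = none
  ex_op : ∀ {k : Kind} (E : Term A K k) (f : Term A K .nd → ℝ≥0∞),
    ex D (op E) f = ex D E fun N => f (op N)
  supp_op : ∀ {k : Kind} (E : Term A K k) (N : Term A K .nd), Supp D (op E) N →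
    ∃ N', Supp D E N' ∧ N = op N'
  act_op : ∀ {N : Term A K .nd} {a b : Option A} {P : Term A K .pr}, Act D N b P → G b a →
    b ∉ some '' H → Act D (op N) a (op P) ∧ a ∉ some '' H
  of_act_op : ∀ {N : Term A K .nd} {a : Option A} {Q : Term A K .pr}, Act D (op N) a Q →
    ∃ P b, Q = op P ∧ Act D N b P ∧ G b a ∧ ∀ h ∈ H, b = some h ↔ a = some h

section
variable {G : Option A → Option A → Prop} {op : ∀ {k : Kind}, Term A K k → Term A K k}

theorem IsLowContext.reach (hop : IsLowContext D H G op) {k : Kind} {E : Term A K k}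
    {N : Term A K .nd} (h : Reach D (op E).st N.st) :
    ∃ N', N = op N' ∧ Reach D E.st N'.st := by
  refine Reach.invariant (I := fun {k'} X => ∃ X' : Term A K k', X = op X' ∧ Reach D E.st X'.st)
    ?_ ?_ ⟨E, rfl, .self _⟩ h
  · rintro _ a Q ⟨M, rfl, hM⟩ hQ
    obtain ⟨P, b, rfl, hP, -⟩ := hop.of_act_op hQ
    exact ⟨P, rfl, hM.act hP⟩
  · rintro _ M ⟨P, rfl, hP⟩ hM
    obtain ⟨N', hN', rfl⟩ := hop.supp_op _ _ hM
    exact ⟨N', rfl, hP.supp hN'⟩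

theorem IsLowContext.strongSim (hop : IsLowContext D H G op) :
    StrongSim D G fun s t => ∃ (k : Kind) (E : Term A K k),
      s = (E.res H).st ∧ t = ((op E).res H).st := by
  constructor
  · rintro s s' ⟨k, E, rfl, rfl⟩ f g hfg
    rw [ex_res, ex_res, hop.ex_op]
    exact ex_mono _ fun N _ => hfg _ _ ⟨_, N, rfl, rfl⟩
  · rintro M s' b a Q ⟨k, E, hM, rfl⟩ hact hG
    cases k with
    | pr => simp at hM
    | nd =>
      obtain rfl : M = E.res H := by simpa using hM
      obtain ⟨P, rfl, hP, hb⟩ := act_res.1 hact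
      obtain ⟨hP', ha⟩ := hop.act_op hP hG hb
      exact ⟨_, _, rfl, .res hP' ha, _, P, rfl, rfl⟩

theorem IsLowContext.ans (hop : IsLowContext D H G op) {k k' k'' : Kind} {X : Term A K k}
    {Y : Term A K k'} {Z : Term A K k''} {a b : Option A} (hG : G b a)
    {C₀ C : Set (Proc A K)}
    (h : Ans D e {r | Bisimilar D e (X.res H).st r} {r | Bisimilar D e (Y.res H).st r} b
      (Z.res H).st)
    (h₀ : ∀ {k : Kind} (X' : Term A K k), Bisimilar D e (X.res H).st (X'.res H).st →
      ((op X').res H).st ∈ C₀)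
    (h₁ : ∀ {k : Kind} (Y' : Term A K k), Bisimilar D e (Y.res H).st (Y'.res H).st →
      ((op Y').res H).st ∈ C) :
    Ans D e C₀ C a ((op Z).res H).st := by
  refine hop.strongSim.ans hop.relabel_none h ⟨_, Z, rfl, rfl⟩ hG ?_ ?_
  · rintro t t' ht ⟨k, X', rfl, rfl⟩
    exact h₀ X' ht
  · rintro t t' ht ⟨k, Y', rfl, rfl⟩
    exact h₁ Y' ht

/-- A low-level move of `op X` stems from one of `X`; its answer by `Y` is pushed through `op` by
`IsLowContext.strongSim`. -/
theorem IsLowContext.bisimilar (hop : IsLowContext D H G op) {k k' : Kind} {X : Term A K k}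
    {Y : Term A K k'} (h : Bisimilar D e (X.res H).st (Y.res H).st) :
    Bisimilar D e ((op X).res H).st ((op Y).res H).st := by
  let R : Proc A K → Proc A K → Prop := fun s t =>
    ∃ (k k' : Kind) (X : Term A K k) (Y : Term A K k'), s = ((op X).res H).st ∧
      t = ((op Y).res H).st ∧ Bisimilar D e (X.res H).st (Y.res H).st
  refine Sim.bisimilar_of_symm (R := R) ⟨?_, ?_⟩ ?_ (.single ⟨_, _, X, Y, rfl, rfl, h⟩)
  · rintro s s' ⟨k, k', X, Y, rfl, rfl, h⟩ f g hfg
    rw [ex_res, ex_res, hop.ex_op, hop.ex_op]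
    exact lift_res h.lift fun N M hNM => hfg _ _ ⟨_, _, N, M, rfl, rfl, hNM⟩
  · rintro M s' a Q ⟨k, k', X, Y, hM, rfl, h⟩ hact
    cases k with
    | pr => simp at hM
    | nd =>
      obtain rfl : M = (op X).res H := by simpa using hM
      obtain ⟨Q, rfl, hQ, ha⟩ := act_res.1 hact
      obtain ⟨P, b, rfl, hP, hG, hb⟩ := hop.of_act_op hQ
      have hbH : b ∉ some '' H := by
        rintro ⟨x, hx, rfl⟩
        exact ha ⟨x, hx, ((hb x hx).1 rfl).symm⟩
      exact hop.ans hG (h.ans_act (.res hP hbH))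
        (fun X' hX' => ⟨_, _, X, X', rfl, rfl, hX'⟩) fun Y' hY' => ⟨_, _, P, Y', rfl, rfl, hY'⟩
  · rintro s t ⟨k, k', X, Y, rfl, rfl, h⟩
    exact ⟨k', k, Y, X, rfl, rfl, h.symm⟩

/-- `op` neither creates nor renames high-level actions, so its high-level transitions come from
those of `E`, whose matching is pushed through `op`. -/
theorem IsLowContext.locallySecure (hop : IsLowContext D H G op) {k : Kind} {E : Term A K k}
    (h : LocallySecure D H e prop E) : LocallySecure D H e prop (op E) := by
  intro M Q x hx hM hact
  obtain ⟨N, rfl, hN⟩ := hop.reach hM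
  obtain ⟨P, b, rfl, hP, hG, hb⟩ := hop.of_act_op hact
  obtain rfl := (hb x hx).2 rfl
  have hm := h N P x hx hN hP
  have hans (hm : Ans D e {r | Bisimilar D e (N.res H).st r} {r | Bisimilar D e (P.res H).st r}
      none (N.res H).st) : Ans D e {r | Bisimilar D e ((op N).res H).st r}
        {r | Bisimilar D e ((op P).res H).st r} none ((op N).res H).st :=
    hop.ans ((hop.relabel_none _).2 rfl) hm (fun X' h => hop.bisimilar h)
      fun Y' h => hop.bisimilar h
  cases prop with
  | SBSNNI => exact hans hm
  | P_BNDC => exact hans hm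
  | SBNDC => exact hop.bisimilar hm

end

theorem isLowContext_res (L : Set A) :
    IsLowContext D H (fun b a => a = b ∧ b ∉ some '' L) (fun E : Term A K _ => E.res L) where
  relabel_none a := by simp
  ex_op E f := ex_res L E f
  supp_op E N h := supp_res.1 h
  act_op h hG hb := ⟨.res (hG.1 ▸ h) (hG.1 ▸ hG.2), hG.1 ▸ hb⟩
  of_act_op h := by
    obtain ⟨P, rfl, hP, ha⟩ := act_res.1 h
    exact ⟨P, _, rfl, hP, ⟨rfl, ha⟩, fun _ _ => Iff.rfl⟩

theorem isLowContext_hide {L : Set A} (hL : L ⊆ Hᶜ) :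
    IsLowContext D H (fun b a => (b ∈ some '' L ∧ a = none) ∨ (b ∉ some '' L ∧ a = b))
      (fun E : Term A K _ => E.hide L) where
  relabel_none a := by simp
  ex_op E f := ex_hide L E f
  supp_op E N h := supp_hide.1 h
  act_op h hG hb := by
    rcases hG with ⟨hbL, rfl⟩ | ⟨hbL, rfl⟩
    · exact ⟨.hideIn h hbL, not_mem_of_eq rfl⟩
    · exact ⟨.hideOut h hbL, hb⟩
  of_act_op h := by
    obtain ⟨P, b, rfl, hP, hG⟩ := act_hide.1 h
    refine ⟨P, b, rfl, hP, hG, fun x hx => ?_⟩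
    rcases hG with ⟨⟨y, hy, rfl⟩, rfl⟩ | ⟨hbL, rfl⟩
    · simp only [Option.some.injEq, reduceCtorEq, iff_false]
      rintro rfl
      exact hL hy hx
    · rfl

end PNI

namespace PNI

variable {A : Type u} {K : Kind → Type v} {D : Equations A K} {H L : Set A} {prop : Property}

/-! ### Parallel composition and branching bisimilarity -/

/-- A nondeterministic process as a process of a given kind. -/
def pad : (k : Kind) → Term A K .nd → Term A K k
  | .nd, N => N
  | .pr, N => one N

theorem supp_pad {k : Kind} (N : Term A K .nd) : Supp D (pad k N) N := by
  cases k with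
  | nd => rfl
  | pr => exact supp_one.2 rfl

/-- Internal moves of a low-level view. -/
theorem weak_res_induction {M : Term A K .nd} {I : ∀ {k : Kind}, Term A K k → Prop} (hM : I M)
    (htau : ∀ (N : Term A K .nd) (P : Term A K .pr), Act D N none P → I P → I N)
    (hsupp : ∀ (P : Term A K .pr) (N : Term A K .nd), Supp D P N → I N → I P)
    {k : Kind} {E : Term A K k} (h : Weak D (E.res H).st (M.res H).st) : I E := by
  have key : ∀ s, Weak D s (M.res H).st → ∀ (k : Kind) (E : Term A K k),
      s = (E.res H).st → I E := by
    intro s hs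
    induction hs using Relation.ReflTransGen.head_induction_on with
    | refl =>
      intro k E hE
      cases k with
      | pr => simp at hE
      | nd =>
        obtain rfl : M = E := by simpa using hE
        exact hM
    | head hstep _ ih =>
      intro k E hE
      cases k with
      | nd =>
        cases hstep with
        | prob => simp at hE
        | @tau N P hact =>
          obtain rfl : N = E.res H := by simpa using hE
          obtain ⟨P, rfl, hP, -⟩ := act_res.1 hact
          exact htau _ _ hP (ih _ P rfl)
      | pr =>
        cases hstep with
        | tau => simp at hE
        | @prob P p N hp =>
          obtain rfl : P = E.res H := by simpa using hE
          obtain ⟨N, hN, rfl⟩ := supp_res.1 hp.supp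
          exact hsupp _ _ hN (ih _ N rfl)
  exact key _ h k E rfl

/-- `pad` keeps the kinds equal: the idle component appears as `[1] M₂` whenever the moving one is
probabilistic. -/
theorem weak_par_left {k : Kind} {E : Term A K k} {M : Term A K .nd} (M₂ : Term A K .nd)
    (h : Weak D (E.res H).st (M.res H).st) :
    Weak D ((Term.par L E (pad k M₂)).res H).st ((Term.par L M M₂).res H).st := by
  refine weak_res_induction (I := fun {k} E => Weak D ((Term.par L E (pad k M₂)).res H).st
    ((Term.par L M M₂).res H).st) .refl ?_ ?_ h
  · intro N P hN hP
    exact .head (.tau (.res (.parLeft hN (not_mem_of_eq rfl)) (not_mem_of_eq rfl))) hP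
  · intro P N hN hP
    exact (Supp.weak (supp_res.2 ⟨_, supp_par.2 ⟨_, _, hN, supp_pad M₂, rfl⟩, rfl⟩)).trans hP

theorem weak_par_right {k : Kind} {E : Term A K k} {M : Term A K .nd} (M₁ : Term A K .nd)
    (h : Weak D (E.res H).st (M.res H).st) :
    Weak D ((Term.par L (pad k M₁) E).res H).st ((Term.par L M₁ M).res H).st := by
  refine weak_res_induction (I := fun {k} E => Weak D ((Term.par L (pad k M₁) E).res H).st
    ((Term.par L M₁ M).res H).st) .refl ?_ ?_ h
  · intro N P hN hP
    exact .head (.tau (.res (.parRight hN (not_mem_of_eq rfl)) (not_mem_of_eq rfl))) hP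
  · intro P N hN hP
    exact (Supp.weak (supp_res.2 ⟨_, supp_par.2 ⟨_, _, supp_pad M₁, hN, rfl⟩, rfl⟩)).trans hP

/-- The first component moves internally, while the second one is at most resolved. -/
theorem exists_weak_par_left {e : BisimKind} {k : Kind} {E₁ E₂ : Term A K k}
    {M₁ N₂ : Term A K .nd} (h : Weak D (E₁.res H).st (M₁.res H).st)
    (h₂ : Bisimilar D e (N₂.res H).st (E₂.res H).st) :
    ∃ M₂ : Term A K .nd, Bisimilar D e (N₂.res H).st (M₂.res H).st ∧
      Weak D ((Term.par L E₁ E₂).res H).st ((Term.par L M₁ M₂).res H).st := by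
  cases k with
  | nd => exact ⟨E₂, h₂, weak_par_left E₂ h⟩
  | pr =>
    -- Both components are resolved by the same transition. Any outcome will do, since all outcomes
    -- of a process bisimilar to a nondeterministic one lie in the same class.
    obtain ⟨M₂, hM₂⟩ := supp_nonempty (D := D) E₂
    refine ⟨M₂, ?_, ?_⟩
    · obtain ⟨N, hN, hb⟩ := h₂.lift.exists_left (supp_res.2 ⟨M₂, hM₂, rfl⟩)
      obtain rfl : N₂.res H = N := hN
      exact hb
    · rcases Relation.ReflTransGen.cases_head h with h | ⟨t, ht, hw⟩
      · simp at h
      · generalize hs : (E₁.res H).st = s at ht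
        cases ht with
        | tau => simp at hs
        | @prob P p N hp =>
          obtain rfl : E₁.res H = P := by simpa using hs
          obtain ⟨N, hN, rfl⟩ := supp_res.1 hp.supp
          exact (Supp.weak (supp_res.2 ⟨_, supp_par.2 ⟨_, _, hN, hM₂, rfl⟩, rfl⟩)).trans
            (weak_par_left M₂ hw)

theorem exists_weak_par_right {e : BisimKind} {k : Kind} {E₁ E₂ : Term A K k}
    {N₁ M₂ : Term A K .nd} (h : Weak D (E₂.res H).st (M₂.res H).st)
    (h₁ : Bisimilar D e (N₁.res H).st (E₁.res H).st) :
    ∃ M₁ : Term A K .nd, Bisimilar D e (N₁.res H).st (M₁.res H).st ∧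
      Weak D ((Term.par L E₁ E₂).res H).st ((Term.par L M₁ M₂).res H).st := by
  cases k with
  | nd => exact ⟨E₁, h₁, weak_par_right E₁ h⟩
  | pr =>
    obtain ⟨M₁, hM₁⟩ := supp_nonempty (D := D) E₁
    refine ⟨M₁, ?_, ?_⟩
    · obtain ⟨N, hN, hb⟩ := h₁.lift.exists_left (supp_res.2 ⟨M₁, hM₁, rfl⟩)
      obtain rfl : N₁.res H = N := hN
      exact hb
    · rcases Relation.ReflTransGen.cases_head h with h | ⟨t, ht, hw⟩
      · simp at h
      · generalize hs : (E₂.res H).st = s at ht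
        cases ht with
        | tau => simp at hs
        | @prob P p N hp =>
          obtain rfl : E₂.res H = P := by simpa using hs
          obtain ⟨N, hN, rfl⟩ := supp_res.1 hp.supp
          exact (Supp.weak (supp_res.2 ⟨_, supp_par.2 ⟨_, _, hM₁, hN, rfl⟩, rfl⟩)).trans
            (weak_par_right M₁ hw)

/-- All derivatives of a restricted term are restricted terms, so the answer can be read off in the
unrestricted process. -/
theorem Ans.pb_res_cases {C₀ C : Set (Proc A K)} {a : Option A} {k : Kind} {Y : Term A K k}
    (h : Ans D .pb C₀ C a (Y.res H).st) :
    (a = none ∧ (Y.res H).st ∈ C) ∨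
      ∃ (M : Term A K .nd) (Q : Term A K .pr), Weak D (Y.res H).st (M.res H).st ∧
        Act D M a Q ∧ (M.res H).st ∈ C₀ ∧ (Q.res H).st ∈ C := by
  have hform : ∀ t, Weak D (Y.res H).st t → ∃ (k : Kind) (E : Term A K k), t = (E.res H).st := by
    intro t ht
    induction ht with
    | refl => exact ⟨_, Y, rfl⟩
    | tail _ hstep ih =>
      obtain ⟨k, E, rfl⟩ := ih
      generalize hs : (E.res H).st = s at hstep
      cases hstep with
      | @tau N P hN =>
        cases k with
        | pr => simp at hs
        | nd =>
          obtain rfl : E.res H = N := by simpa using hs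
          obtain ⟨P, rfl, -⟩ := act_res.1 hN
          exact ⟨_, P, rfl⟩
      | @prob P p N hp =>
        cases k with
        | nd => simp at hs
        | pr =>
          obtain rfl : E.res H = P := by simpa using hs
          obtain ⟨N, -, rfl⟩ := supp_res.1 hp.supp
          exact ⟨_, N, rfl⟩
  refine h.imp id ?_
  rintro ⟨M, Q, hw, hM, hNM, hPQ⟩
  obtain ⟨k', E, hE⟩ := hform _ hw
  cases k' with
  | pr => simp at hE
  | nd =>
    obtain rfl : M = E.res H := by simpa using hE
    obtain ⟨Q, rfl, hQ, -⟩ := act_res.1 hM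
    exact ⟨E, Q, hw, hQ, hNM, hPQ⟩

/-- Branching bisimilarity of low-level views is preserved by parallel composition. -/
theorem par_res_bisimilar {k k' : Kind} {X₁ X₂ : Term A K k} {Y₁ Y₂ : Term A K k'}
    (h₁ : Bisimilar D .pb (X₁.res H).st (Y₁.res H).st)
    (h₂ : Bisimilar D .pb (X₂.res H).st (Y₂.res H).st) :
    Bisimilar D .pb ((Term.par L X₁ X₂).res H).st ((Term.par L Y₁ Y₂).res H).st := by
  let R : Proc A K → Proc A K → Prop := fun s t =>
    ∃ (k k' : Kind) (X₁ X₂ : Term A K k) (Y₁ Y₂ : Term A K k'),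
      s = ((Term.par L X₁ X₂).res H).st ∧ t = ((Term.par L Y₁ Y₂).res H).st ∧
      Bisimilar D .pb (X₁.res H).st (Y₁.res H).st ∧ Bisimilar D .pb (X₂.res H).st (Y₂.res H).st
  refine Sim.bisimilar_of_symm (R := R) ⟨?_, ?_⟩ ?_
    (.single ⟨_, _, X₁, X₂, Y₁, Y₂, rfl, rfl, h₁, h₂⟩)
  · rintro s s' ⟨k, k', X₁, X₂, Y₁, Y₂, rfl, rfl, h₁, h₂⟩ f g hfg
    rw [ex_res, ex_res, ex_par, ex_par]
    exact lift_res h₁.lift fun N₁ M₁ hNM₁ => lift_res h₂.lift fun N₂ M₂ hNM₂ =>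
      hfg _ _ ⟨_, _, N₁, N₂, M₁, M₂, rfl, rfl, hNM₁, hNM₂⟩
  · rintro M s' a Q ⟨k, k', N₁, N₂, Y₁, Y₂, hM, rfl, h₁, h₂⟩ hact
    cases k with
    | pr => simp at hM
    | nd =>
    obtain rfl : M = (Term.par L N₁ N₂).res H := by simpa using hM
    obtain ⟨Q, rfl, hQ, ha⟩ := act_res.1 hact
    rcases act_par.1 hQ with ⟨P₁, rfl, hP₁, haL⟩ | ⟨P₂, rfl, hP₂, haL⟩ |
      ⟨P₁, P₂, rfl, hP₁, hP₂, haL⟩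
    · have hone := one_res_bisimilar (D := D) (e := .pb) N₂ H
      rcases (h₁.ans_act (.res hP₁ ha)).pb_res_cases with ⟨rfl, hst⟩ | ⟨M₁, Q₁, hw, hM₁, hNM₁, hPQ₁⟩
      · exact .inl ⟨rfl, _, _, _, _, _, _, rfl, rfl, hst, hone.trans h₂⟩
      · obtain ⟨M₂, hNM₂, hw'⟩ := exists_weak_par_left (L := L) hw h₂
        exact .inr ⟨_, _, hw', .res (.parLeft hM₁ haL) ha,
          ⟨_, _, _, _, _, _, rfl, rfl, hNM₁, hNM₂⟩, ⟨_, _, _, _, _, _, rfl, rfl, hPQ₁,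
            (hone.trans hNM₂).trans (one_res_bisimilar M₂ H).symm⟩⟩
    · have hone := one_res_bisimilar (D := D) (e := .pb) N₁ H
      rcases (h₂.ans_act (.res hP₂ ha)).pb_res_cases with ⟨rfl, hst⟩ | ⟨M₂, Q₂, hw, hM₂, hNM₂, hPQ₂⟩
      · exact .inl ⟨rfl, _, _, _, _, _, _, rfl, rfl, hone.trans h₁, hst⟩
      · obtain ⟨M₁, hNM₁, hw'⟩ := exists_weak_par_right (L := L) hw h₁
        exact .inr ⟨_, _, hw', .res (.parRight hM₂ haL) ha,
          ⟨_, _, _, _, _, _, rfl, rfl, hNM₁, hNM₂⟩, ⟨_, _, _, _, _, _, rfl, rfl,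
            (hone.trans hNM₁).trans (one_res_bisimilar M₁ H).symm, hPQ₂⟩⟩
    · have hne : a ≠ none := fun h => not_mem_of_eq h haL
      obtain ⟨M₁, Q₁, hw₁, hM₁, hNM₁, hPQ₁⟩ :=
        ((h₁.ans_act (.res hP₁ ha)).pb_res_cases).resolve_left fun h => hne h.1
      -- The first component gets ready while the second is at most resolved and stays in its class;
      -- the second then gets ready while the first waits. Only after that do they synchronize.
      obtain ⟨M, hNM, hw⟩ := exists_weak_par_left (L := L) hw₁ h₂
      obtain ⟨M₂, Q₂, hw₂, hM₂, hNM₂, hPQ₂⟩ :=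
        ((hNM.ans_act (.res hP₂ ha)).pb_res_cases).resolve_left fun h => hne h.1
      exact .inr ⟨_, _, hw.trans (weak_par_right M₁ hw₂), .res (.synch hM₁ hM₂ haL) ha,
        ⟨_, _, _, _, _, _, rfl, rfl, hNM₁, hNM₂⟩, ⟨_, _, _, _, _, _, rfl, rfl, hPQ₁, hPQ₂⟩⟩
  · rintro s t ⟨k, k', X₁, X₂, Y₁, Y₂, rfl, rfl, h₁, h₂⟩
    exact ⟨_, _, Y₁, Y₂, X₁, X₂, rfl, rfl, h₁.symm, h₂.symm⟩

/-- The components are reachable only because reachability includes the processes `[1] N`, in which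
idle components are wrapped. -/
theorem Reach.par {k : Kind} {E₁ E₂ : Term A K k} {N : Term A K .nd}
    (h : Reach D (Term.par L E₁ E₂).st N.st) : ∃ N₁ N₂ : Term A K .nd,
      N = .par L N₁ N₂ ∧ Reach D E₁.st N₁.st ∧ Reach D E₂.st N₂.st := by
  refine Reach.invariant (I := fun {k'} X => ∃ X₁ X₂ : Term A K k',
    X = .par L X₁ X₂ ∧ Reach D E₁.st X₁.st ∧ Reach D E₂.st X₂.st) ?_ ?_
    ⟨E₁, E₂, rfl, .self _, .self _⟩ h
  · rintro _ a Q ⟨N₁, N₂, rfl, h₁, h₂⟩ hQ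
    rcases act_par.1 hQ with ⟨P₁, rfl, hP, -⟩ | ⟨P₂, rfl, hP, -⟩ | ⟨P₁, P₂, rfl, hP, hP', -⟩
    · exact ⟨_, _, rfl, h₁.act hP, h₂.toOne⟩
    · exact ⟨_, _, rfl, h₁.toOne, h₂.act hP⟩
    · exact ⟨_, _, rfl, h₁.act hP, h₂.act hP'⟩
  · rintro _ M ⟨P₁, P₂, rfl, h₁, h₂⟩ hM
    obtain ⟨N₁, N₂, hN₁, hN₂, rfl⟩ := supp_par.1 hM
    exact ⟨N₁, N₂, rfl, h₁.supp hN₁, h₂.supp hN₂⟩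

/-- A branching answer to a high-level transition is kept in parallel contexts. -/
theorem ans_par_left {N₁ N₂ : Term A K .nd} {P₁ : Term A K .pr}
    (h : Ans D .pb {r | Bisimilar D .pb (N₁.res H).st r} {r | Bisimilar D .pb (P₁.res H).st r}
      none (N₁.res H).st) :
    Ans D .pb {r | Bisimilar D .pb ((Term.par L N₁ N₂).res H).st r}
      {r | Bisimilar D .pb ((Term.par L P₁ (one N₂)).res H).st r} none
      ((Term.par L N₁ N₂).res H).st := by
  have hone := one_res_bisimilar (D := D) (e := .pb) N₂ H
  rcases h.pb_res_cases with ⟨-, hP⟩ | ⟨M, Q, hw, hM, hNM, hPQ⟩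
  · exact .halt (par_res_bisimilar hP hone)
  · exact .inr ⟨_, _, weak_par_left N₂ hw,
      .res (.parLeft hM (not_mem_of_eq rfl)) (not_mem_of_eq rfl),
      par_res_bisimilar hNM (.refl _), par_res_bisimilar hPQ (.refl _)⟩

theorem ans_par_right {N₁ N₂ : Term A K .nd} {P₂ : Term A K .pr}
    (h : Ans D .pb {r | Bisimilar D .pb (N₂.res H).st r} {r | Bisimilar D .pb (P₂.res H).st r}
      none (N₂.res H).st) :
    Ans D .pb {r | Bisimilar D .pb ((Term.par L N₁ N₂).res H).st r}
      {r | Bisimilar D .pb ((Term.par L (one N₁) P₂).res H).st r} none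
      ((Term.par L N₁ N₂).res H).st := by
  have hone := one_res_bisimilar (D := D) (e := .pb) N₁ H
  rcases h.pb_res_cases with ⟨-, hP⟩ | ⟨M, Q, hw, hM, hNM, hPQ⟩
  · exact .halt (par_res_bisimilar hone hP)
  · exact .inr ⟨_, _, weak_par_right N₁ hw,
      .res (.parRight hM (not_mem_of_eq rfl)) (not_mem_of_eq rfl),
      par_res_bisimilar (.refl _) hNM, par_res_bisimilar (.refl _) hPQ⟩

/-- An asynchronous high-level move is matched by the moving component alone. A synchronized one
requires a high-level action in `L`, which is allowed for SBNDC only, where the congruence applies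
to both components at once. -/
theorem LocallySecure.par {k : Kind} {E₁ E₂ : Term A K k} (hL : L ⊆ Hᶜ ∨ prop = .SBNDC)
    (h₁ : LocallySecure D H .pb prop E₁) (h₂ : LocallySecure D H .pb prop E₂) :
    LocallySecure D H .pb prop (.par L E₁ E₂) := by
  intro M Q x hx hM hact
  obtain ⟨N₁, N₂, rfl, hN₁, hN₂⟩ := hM.par
  rcases act_par.1 hact with ⟨P₁, rfl, hP₁, -⟩ | ⟨P₂, rfl, hP₂, -⟩ | ⟨P₁, P₂, rfl, hP₁, hP₂, hxL⟩
  · have hm := h₁ N₁ P₁ x hx hN₁ hP₁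
    cases prop with
    | SBSNNI => exact ans_par_left hm
    | P_BNDC => exact ans_par_left hm
    | SBNDC => exact par_res_bisimilar hm (one_res_bisimilar N₂ H).symm
  · have hm := h₂ N₂ P₂ x hx hN₂ hP₂
    cases prop with
    | SBSNNI => exact ans_par_right hm
    | P_BNDC => exact ans_par_right hm
    | SBNDC => exact par_res_bisimilar (one_res_bisimilar N₁ H).symm hm
  · rcases hL with hL | rfl
    · obtain ⟨y, hy, hyx⟩ := hxL
      obtain rfl : y = x := by simpa using hyx
      exact absurd hx (hL hy)
    · exact par_res_bisimilar (h₁ N₁ P₁ x hx hN₁ hP₁) (h₂ N₂ P₂ x hx hN₂ hP₂)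

end PNI

namespace PNI

variable {A : Type u} {K : Kind → Type v} {D : Equations A K} {H : Set A} {e : BisimKind}
  {prop : Property}

/-! ### Failure of compositionality for weak probabilistic bisimilarity -/

theorem act_nil {a : Option A} {Q : Term A K .pr} : ¬ Act D .nil a Q := by
  intro h
  cases h

theorem act_pre {a b : Option A} {P Q : Term A K .pr} :
    Act D (.pre a P) b Q ↔ b = a ∧ Q = P := by
  constructor
  · intro h
    cases h
    exact ⟨rfl, rfl⟩
  · rintro ⟨rfl, rfl⟩
    exact .pre _ _

theorem act_alt {N₁ N₂ : Term A K .nd} {a : Option A} {Q : Term A K .pr} :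
    Act D (.alt N₁ N₂) a Q ↔ Act D N₁ a Q ∨ Act D N₂ a Q := by
  constructor
  · intro h
    cases h with
    | altLeft h => exact .inl h
    | altRight h => exact .inr h
  · rintro (h | h)
    · exact .altLeft h
    · exact .altRight h

/-- The process `[1/2] N ⊕ [1/2] M`. -/
noncomputable def fair (N M : Term A K .nd) : Term A K .pr :=
  .choice (m := 2) (fun _ => 2⁻¹) (fun _ => by simp) (by simp) ![N, M]

theorem supp_fair {N M Z : Term A K .nd} : Supp D (fair N M) Z ↔ Z = N ∨ Z = M := by
  constructor
  · rintro ⟨p, ⟨h⟩⟩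
    generalize hP : fair N M = P at h
    cases h with
    | choice p hpos hsum N' j =>
      simp only [fair, Term.choice.injEq] at hP
      obtain ⟨rfl, hp, hN⟩ := hP
      rw [← eq_of_heq hN]
      fin_cases j <;> simp
    | _ => simp [fair] at hP
  · rintro (rfl | rfl)
    · exact ⟨2⁻¹, ⟨.choice (m := 2) (fun _ => 2⁻¹) (fun _ => by simp) (by simp) ![Z, M] 0⟩⟩
    · exact ⟨2⁻¹, ⟨.choice (m := 2) (fun _ => 2⁻¹) (fun _ => by simp) (by simp) ![N, Z] 1⟩⟩

/-- A play of positive probability has a branch that ends by halting in `C`, and an invariant of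
states paired with the remaining trace holds there. -/
theorem AS.exists_halt {C : Set (Proc A K)} {I : Option A → Proc A K → Prop}
    (htau : ∀ m (N : Term A K .nd) (P : Term A K .pr), I m N.st → Act D N none P → I m P.st)
    (hvis : ∀ a (N : Term A K .nd) (P : Term A K .pr), I (some a) N.st → Act D N (some a) P →
      I none P.st)
    (hsupp : ∀ m (P : Term A K .pr) (N : Term A K .nd), I m P.st → Supp D P N → I m N.st)
    {m : Option A} {s : Proc A K} (h : AS D C m s) (hI : I m s) : ∃ t ∈ C, I none t := by
  have key {W : Option A → Proc A K → Prop} {m s q} (h : Play D C W m s q) :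
      q ≠ 0 → I m s → ∃ t ∈ C, I none t := by
    induction h with
    | halt h => exact fun _ hI => ⟨_, h, hI⟩
    | defer => exact fun h => absurd rfl h
    | tau hN _ ih => exact fun hq hI => ih hq (htau _ _ _ hI hN)
    | vis hN _ ih => exact fun hq hI => ih hq (hvis _ _ _ hI hN)
    | flip q _ ih =>
      intro hq hI
      obtain ⟨N, hN, hqN⟩ := exists_supp_of_ex_ne_zero hq
      exact ih N hN hqN (hsupp _ _ _ hI hN)
    | weaken _ hq ih => exact fun hq' hI => ih (fun h => hq' (by simpa [h] using hq)) hI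
  exact key h.play (by simp) hI

theorem AS.of_stuck {C : Set (Proc A K)} {m : Option A} {N : Term A K .nd}
    (h : AS D C m N.st) (hN : ∀ b P, Act D N b P → b ≠ none ∧ b ≠ m) : m = none ∧ N.st ∈ C := by
  suffices hex : ∃ t ∈ C, none = m ∧ t = N.st by
    obtain ⟨t, ht, hm, rfl⟩ := hex
    exact ⟨hm.symm, ht⟩
  refine AS.exists_halt (I := fun m' s => m' = m ∧ s = N.st) ?_ ?_ ?_ h ⟨rfl, rfl⟩
  · rintro m' N' P ⟨rfl, hN'⟩ hact
    obtain rfl : N' = N := by simpa using hN'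
    exact absurd rfl (hN _ _ hact).1
  · rintro a N' P ⟨rfl, hN'⟩ hact
    obtain rfl : N' = N := by simpa using hN'
    exact absurd rfl (hN _ _ hact).2
  · rintro m' P N' ⟨rfl, hP⟩ hact
    simp at hP

/-- The silent answer is the weakest form of matching, so refuting it refutes all three properties
at once. -/
theorem Matches.ans {s t : Proc A K} (h : Matches D e prop s t) :
    Ans D e {r | Bisimilar D e s r} {r | Bisimilar D e t r} none s := by
  cases prop with
  | SBNDC => exact .halt (Bisimilar.symm h)
  | SBSNNI => exact h
  | P_BNDC => exact h

theorem Matches.of_bisimilar {s t : Proc A K} (h : Bisimilar D e s t) :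
    Matches D e prop s t := by
  cases prop with
  | SBNDC => exact h
  | SBSNNI => exact .halt h.symm
  | P_BNDC => exact .halt h.symm

/-! ### Local security transition by transition -/

theorem LocallySecure.of_step_nd {N : Term A K .nd}
    (h : ∀ (P : Term A K .pr) (x : A), x ∈ H → Act D N (some x) P →
      Matches D e prop (N.res H).st (P.res H).st)
    (hstep : ∀ (a : Option A) (P : Term A K .pr), Act D N a P → LocallySecure D H e prop P) :
    LocallySecure D H e prop N := by
  intro M P x hx hM hact
  rcases Relation.ReflTransGen.cases_head hM.steps_nd with hM' | ⟨t, ht, hM'⟩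
  · obtain rfl : N = M := by simpa using hM'
    exact h P x hx hact
  · rcases ht.kind_cases with ⟨N', b, Q, hN', rfl, hQ⟩ | ⟨Q, N', hQ, -⟩
    · obtain rfl : N = N' := by simpa using hN'
      exact hstep _ _ hQ M P x hx (.comp hM') hact
    · simp at hQ

theorem LocallySecure.of_supp {Q : Term A K .pr}
    (hstep : ∀ N : Term A K .nd, Supp D Q N → LocallySecure D H e prop N) :
    LocallySecure D H e prop Q := by
  intro M P x hx hM hact
  rcases Relation.ReflTransGen.cases_head hM.steps_nd with hM' | ⟨t, ht, hM'⟩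
  · simp at hM'
  · rcases ht.kind_cases with ⟨N', b, Q', hN', -⟩ | ⟨Q', N', hQ', rfl, hS⟩
    · simp at hN'
    · obtain rfl : Q = Q' := by simpa using hQ'
      exact hstep _ hS M P x hx (.comp hM') hact

theorem LocallySecure.nil : LocallySecure D H e prop (.nil : Term A K .nd) :=
  .of_step_nd (fun _ _ _ h => absurd h act_nil) fun _ _ h => absurd h act_nil

theorem LocallySecure.one {N : Term A K .nd} (h : LocallySecure D H e prop N) :
    LocallySecure D H e prop (one N) :=
  .of_supp fun _ hM => supp_one.1 hM ▸ h

theorem LocallySecure.fair {N M : Term A K .nd} (h : LocallySecure D H e prop N)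
    (h' : LocallySecure D H e prop M) : LocallySecure D H e prop (fair N M) :=
  .of_supp fun _ hZ => (supp_fair.1 hZ).elim (fun hZ => hZ ▸ h) fun hZ => hZ ▸ h'

/-- Alternative composition is harmless if its initial high-level transitions are matched. -/
theorem LocallySecure.alt {N M : Term A K .nd} (h : LocallySecure D H e prop N)
    (h' : LocallySecure D H e prop M)
    (hhigh : ∀ (P : Term A K .pr) (x : A), x ∈ H → Act D (.alt N M) (some x) P →
      Matches D e prop ((Term.alt N M).res H).st (P.res H).st) :
    LocallySecure D H e prop (.alt N M) :=
  .of_step_nd hhigh fun _ _ hact => (act_alt.1 hact).elim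
    (fun hN => h.of_reach ((Reach.self _).act hN)) fun hM => h'.of_reach ((Reach.self _).act hM)

/-- The process `a . [1] 0`. -/
def single (a : A) : Term A K .nd := .pre (some a) (one .nil)

/-- The process `τ . 0 + d . 0`. -/
def tauOr (d : A) : Term A K .nd := .alt (.pre none (one .nil)) (single d)

/-- The process `a . (τ . 0 + d . 0) + a . 0`. -/
def saturated (a d : A) : Term A K .nd := .alt (.pre (some a) (one (tauOr d))) (single a)

/-- The process `a . (τ . 0 + d . 0) + h . (a . (τ . 0 + d . 0) + a . 0)`. -/
def highSaturated (h a d : A) : Term A K .nd :=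
  .alt (.pre (some a) (one (tauOr d))) (.pre (some h) (one (saturated a d)))

/-- The process `a . ([1/2] b . 0 ⊕ [1/2] c . 0)`. -/
noncomputable def tossing (a b c : A) : Term A K .nd := .pre (some a) (fair (single b) (single c))

theorem not_mem_image {a : A} {L : Set A} (h : a ∉ L) : some a ∉ some '' L := by simpa using h

theorem locallySecure_single {a : A} (ha : a ∉ H) :
    LocallySecure D H e prop (single a : Term A K .nd) :=
  .pre (not_mem_image ha) (.one .nil)

theorem locallySecure_tossing {a b c : A} (ha : a ∉ H) (hb : b ∉ H) (hc : c ∉ H) :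
    LocallySecure D H e prop (tossing a b c : Term A K .nd) :=
  .pre (not_mem_image ha) (.fair (locallySecure_single hb) (locallySecure_single hc))

theorem locallySecure_tauOr {d : A} (hd : d ∉ H) :
    LocallySecure D H e prop (tauOr d : Term A K .nd) := by
  refine .alt (.pre (not_mem_of_eq rfl) (.one .nil)) (locallySecure_single hd) ?_
  intro P x hx hact
  simp only [act_alt, act_pre, single] at hact
  rcases hact with ⟨hx', -⟩ | ⟨hx', -⟩
  · simp at hx'
  · obtain rfl : x = d := by simpa using hx'
    exact absurd hx hd

theorem locallySecure_saturated {a d : A} (ha : a ∉ H) (hd : d ∉ H) :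
    LocallySecure D H e prop (saturated a d : Term A K .nd) := by
  refine .alt (.pre (not_mem_image ha) (.one (locallySecure_tauOr hd)))
    (locallySecure_single ha) ?_
  intro P x hx hact
  simp only [act_alt, act_pre, single] at hact
  obtain rfl : x = a := by rcases hact with ⟨hx', -⟩ | ⟨hx', -⟩ <;> simpa using hx'
  exact absurd hx ha

/-- Without `h`, the processes differ by the summand `a . 0`, and a weak answer may perform `a`
followed by the `τ` of `tauOr`. -/
theorem highSaturated_bisimilar {h a d : A} (hh : h ∈ H) (ha : a ∉ H) :
    Bisimilar D .pw ((highSaturated h a d).res H : Term A K .nd).st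
      ((saturated a d).res H).st := by
  let R : Proc A K → Proc A K → Prop := fun s t => s = t ∨
    (s = ((highSaturated h a d).res H).st ∧ t = ((saturated a d).res H).st) ∨
    (s = ((saturated a d).res H).st ∧ t = ((highSaturated h a d).res H).st)
  have haH := not_mem_image ha
  refine Sim.bisimilar_of_symm (R := R) ⟨?_, ?_⟩ ?_ (.single (.inr (.inl ⟨rfl, rfl⟩)))
  · rintro s t (rfl | ⟨rfl, rfl⟩ | ⟨rfl, rfl⟩)
    · exact Lift.refl (fun _ => .inl rfl) _
    · exact fun f g hfg => hfg _ _ (.inr (.inl ⟨rfl, rfl⟩))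
    · exact fun f g hfg => hfg _ _ (.inr (.inr ⟨rfl, rfl⟩))
  · rintro N t l Q (rfl | ⟨hN, rfl⟩ | ⟨hN, rfl⟩) hact
    · exact .act hact (.inl rfl) (.inl rfl)
    · obtain rfl : N = (highSaturated h a d).res H := by simpa using hN
      obtain ⟨P, rfl, hP, hl⟩ := act_res.1 hact
      simp only [highSaturated, act_alt, act_pre] at hP
      rcases hP with ⟨rfl, rfl⟩ | ⟨rfl, rfl⟩
      · exact AS.act (.res (.altLeft (.pre _ _)) haH) (.inl rfl)
      · exact absurd ⟨h, hh, rfl⟩ hl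
    · obtain rfl : N = (saturated a d).res H := by simpa using hN
      obtain ⟨P, rfl, hP, hl⟩ := act_res.1 hact
      simp only [saturated, single, act_alt, act_pre] at hP
      rcases hP with ⟨rfl, rfl⟩ | ⟨rfl, rfl⟩
      · exact AS.act (.res (.altLeft (.pre _ _)) haH) (.inl rfl)
      · refine AS.vis (.res (.altLeft (.pre _ _)) haH) (AS.resolve fun M hM => ?_)
        obtain ⟨M', hM', rfl⟩ := supp_res.1 hM
        obtain rfl := supp_one.1 hM'
        exact AS.act (.res (.altLeft (.pre _ _)) (not_mem_of_eq rfl)) (.inl rfl)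
  · rintro s t (rfl | ⟨rfl, rfl⟩ | ⟨rfl, rfl⟩)
    · exact .inl rfl
    · exact .inr (.inr ⟨rfl, rfl⟩)
    · exact .inr (.inl ⟨rfl, rfl⟩)

theorem locallySecure_highSaturated {h a d : A} (hh : h ∈ H) (ha : a ∉ H) (hd : d ∉ H) :
    LocallySecure D H .pw prop (highSaturated h a d : Term A K .nd) := by
  refine .of_step_nd ?_ ?_
  · intro P x hx hact
    simp only [highSaturated, act_alt, act_pre] at hact
    rcases hact with ⟨hx', rfl⟩ | ⟨hx', rfl⟩
    · obtain rfl : x = a := by simpa using hx'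
      exact absurd hx ha
    · exact .of_bisimilar ((highSaturated_bisimilar hh ha).trans (one_res_bisimilar _ H).symm)
  · intro l P hact
    simp only [highSaturated, act_alt, act_pre] at hact
    rcases hact with ⟨-, rfl⟩ | ⟨-, rfl⟩
    · exact .one (locallySecure_tauOr hd)
    · exact .one (locallySecure_saturated ha hd)

/-! ### A synchronized answer that cannot be imitated weakly -/

section
variable {h a b c d : A}

/-- The low-level view of a process running in parallel with another one, synchronizing on `a`. -/
abbrev sync (H : Set A) (a : A) {k : Kind} (E F : Term A K k) : Term A K k :=
  (Term.par {a} E F).res H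

theorem act_sync_single_nil {l : Option A} {Q : Term A K .pr}
    (hact : Act D (sync H a (single b) .nil) l Q) : l = some b := by
  obtain ⟨P, rfl, hP, -⟩ := act_res.1 hact
  simp only [act_par, single, act_pre, act_nil, false_and, and_false, exists_false,
    or_false] at hP
  obtain ⟨-, -, ⟨hl, -⟩, -⟩ := hP
  exact hl

theorem not_bisimilar_sync_single (hbH : b ∉ H) (hba : b ≠ a) (hbc : b ≠ c) :
    ¬ Bisimilar D .pw (sync H a (single b) .nil : Term A K .nd).st
      (sync H a (single c) .nil).st := by
  intro hbis
  have hans := hbis.ans_act (.res (.parLeft (.pre _ _) (not_mem_image (by simpa using hba)))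
    (not_mem_image hbH))
  have := AS.of_stuck hans fun l P hact => by
    rw [act_sync_single_nil hact]
    simpa using hbc.symm
  simp at this

/-- The right-hand side can still perform `d`; the left-hand side offers nothing but `b`. -/
theorem not_bisimilar_sync_tauOr (hdH : d ∉ H) (hda : d ≠ a) (hbd : b ≠ d)
    {N : Term A K .nd} :
    ¬ Bisimilar D .pw (sync H a (single b) .nil : Term A K .nd).st
      (sync H a N (tauOr d)).st := by
  intro hbis
  have hans := hbis.symm.ans_act (.res (.parRight (.altRight (.pre _ _))
    (not_mem_image (by simpa using hda))) (not_mem_image hdH))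
  have := AS.of_stuck hans fun l P hact => by
    rw [act_sync_single_nil hact]
    simpa using hbd
  simp at this

/-- The class of the process reached by the direct answer is not reached almost surely. -/
theorem not_as_sync (hhH : h ∈ H) (haH : a ∉ H) (hbH : b ∉ H) (hdH : d ∉ H) (hba : b ≠ a)
    (hbc : b ≠ c) (hda : d ≠ a) (hbd : b ≠ d) :
    ¬ AS D {r | Bisimilar D .pw (sync H a (fair (single b) (single c)) (one .nil)).st r} (some a)
      (sync H a (tossing a b c) (highSaturated h a d) : Term A K .nd).st := by
  intro has
  -- All states that an answer can visit, with the trace left: before `a`, just after it, and after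
  -- the coin has been tossed, before or after the `τ` of the second component.
  let I : Option A → Proc A K → Prop := fun m s =>
    (m = some a ∧ s = (sync H a (tossing a b c) (highSaturated h a d)).st) ∨
    (m = none ∧ s = (sync H a (fair (single b) (single c)) (one (tauOr d))).st) ∨
    (m = none ∧ ∃ l : A, (l = b ∨ l = c) ∧ (s = (sync H a (single l) (tauOr d)).st ∨
      s = (sync H a (one (single l)) (one .nil)).st ∨ s = (sync H a (single l) .nil).st))
  have hfirst : ∀ (l : Option A) (Q : Term A K .pr),
      Act D (sync H a (tossing a b c) (highSaturated h a d)) l Q →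
      l = some a ∧ Q = sync H a (fair (single b) (single c)) (one (tauOr d)) := by
    intro l Q hact
    obtain ⟨P, rfl, hP, hl⟩ := act_res.1 hact
    simp only [act_par, tossing, highSaturated, act_pre, act_alt] at hP
    rcases hP with ⟨P₁, rfl, ⟨rfl, rfl⟩, ha⟩ | ⟨P₂, rfl, ⟨rfl, rfl⟩ | ⟨rfl, rfl⟩, ha⟩ |
      ⟨P₁, P₂, rfl, ⟨rfl, rfl⟩, ⟨-, rfl⟩ | ⟨hah, rfl⟩, -⟩
    · simp at ha
    · simp at ha
    · exact absurd ⟨h, hhH, rfl⟩ hl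
    · exact ⟨rfl, rfl⟩
    · obtain rfl : a = h := by simpa using hah
      exact absurd hhH haH
  suffices hex : ¬ ∃ r ∈ {r | Bisimilar D .pw (sync H a (fair (single b) (single c))
      (one .nil)).st r}, I none r by
    refine hex (AS.exists_halt (I := I) ?_ ?_ ?_ has (.inl ⟨rfl, rfl⟩))
    · rintro m N P (⟨rfl, hN⟩ | ⟨rfl, hN⟩ | ⟨rfl, l, hl, hN | hN | hN⟩) hact
      · obtain rfl : N = sync H a (tossing a b c) (highSaturated h a d) := by simpa using hN
        simpa using (hfirst _ _ hact).1
      · simp at hN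
      · obtain rfl : N = sync H a (single l) (tauOr d) := by simpa using hN
        obtain ⟨P, rfl, hP, -⟩ := act_res.1 hact
        simp only [act_par, single, tauOr, act_pre, act_alt] at hP
        rcases hP with ⟨P₁, rfl, ⟨h, -⟩, -⟩ | ⟨P₂, rfl, ⟨-, rfl⟩ | ⟨h, -⟩, -⟩ |
          ⟨P₁, P₂, rfl, ⟨h, -⟩, -⟩
        · simp at h
        · exact .inr (.inr ⟨rfl, l, hl, .inr (.inl rfl)⟩)
        · simp at h
        · simp at h
      · simp at hN
      · obtain rfl : N = sync H a (single l) .nil := by simpa using hN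
        simpa using act_sync_single_nil hact
    · rintro m N P (⟨hm, hN⟩ | ⟨hm, -⟩ | ⟨hm, -⟩) hact
      · obtain rfl : N = sync H a (tossing a b c) (highSaturated h a d) := by simpa using hN
        exact .inr (.inl ⟨rfl, by rw [(hfirst _ _ hact).2]⟩)
      · simp at hm
      · simp at hm
    · rintro m P N (⟨rfl, hP⟩ | ⟨rfl, hP⟩ | ⟨rfl, l, hl, hP | hP | hP⟩) hS
      · simp at hP
      · obtain rfl : P = sync H a (fair (single b) (single c)) (one (tauOr d)) := by simpa using hP
        obtain ⟨M, hM, rfl⟩ := supp_res.1 hS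
        obtain ⟨N₁, N₂, hN₁, hN₂, rfl⟩ := supp_par.1 hM
        obtain rfl := supp_one.1 hN₂
        rcases supp_fair.1 hN₁ with rfl | rfl
        · exact .inr (.inr ⟨rfl, b, .inl rfl, .inl rfl⟩)
        · exact .inr (.inr ⟨rfl, c, .inr rfl, .inl rfl⟩)
      · simp at hP
      · obtain rfl : P = sync H a (one (single l)) (one .nil) := by simpa using hP
        obtain ⟨M, hM, rfl⟩ := supp_res.1 hS
        obtain ⟨N₁, N₂, hN₁, hN₂, rfl⟩ := supp_par.1 hM
        obtain rfl := supp_one.1 hN₁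
        obtain rfl := supp_one.1 hN₂
        exact .inr (.inr ⟨rfl, l, hl, .inr (.inr rfl)⟩)
      · simp at hP
  rintro ⟨r, hr, hI⟩
  have hsupp {l : A} (hl : l = b ∨ l = c) : Supp D (sync H a (fair (single b) (single c))
      (one .nil)) (sync H a (single l) .nil) := by
    refine supp_res.2 ⟨_, supp_par.2 ⟨_, _, supp_fair.2 ?_, supp_one.2 rfl, rfl⟩, rfl⟩
    rcases hl with rfl | rfl
    · exact .inl rfl
    · exact .inr rfl
  -- A process in the target class resolves both in a state that offers `b` and in one that offers
  -- `c`. Before the toss has been resolved the outcomes still offer `d`; afterwards only one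
  -- outcome is left.
  have hlift := Bisimilar.lift (show Bisimilar D .pw _ r from hr)
  obtain ⟨Nb, hNb, hb⟩ := hlift.exists_right (hsupp (.inl rfl))
  obtain ⟨Nc, hNc, hc⟩ := hlift.exists_right (hsupp (.inr rfl))
  have huniq : Nb ≠ Nc := by
    rintro rfl
    exact not_bisimilar_sync_single hbH hba hbc (hb.trans hc.symm)
  rcases hI with ⟨h, -⟩ | ⟨-, rfl⟩ | ⟨-, l, -, rfl | rfl | rfl⟩
  · simp at h
  · obtain ⟨M, hM, rfl⟩ := supp_res.1 hNb
    obtain ⟨N₁, N₂, -, hN₂, rfl⟩ := supp_par.1 hM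
    obtain rfl := supp_one.1 hN₂
    exact not_bisimilar_sync_tauOr hdH hda hbd hb
  · exact huniq (Eq.trans (Eq.symm hNb) hNc)
  · have hall {N} (hN : Supp D (sync H a (one (single l)) (one .nil)) N) :
        N = (sync H a (single l) .nil : Term A K .nd) := by
      obtain ⟨M, hM, rfl⟩ := supp_res.1 hN
      obtain ⟨N₁, N₂, hN₁, hN₂, rfl⟩ := supp_par.1 hM
      rw [supp_one.1 hN₁, supp_one.1 hN₂]
    exact huniq ((hall hNb).trans (hall hNc).symm)
  · exact huniq (Eq.trans (Eq.symm hNb) hNc)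

/-- The low-level view of the composition has no silent move, so matching would make it bisimilar to
the view after `h`. The latter can synchronize on the summand `a . 0`, which `not_as_sync` shows
cannot be answered. -/
theorem not_locallySecure_par (hhH : h ∈ H) (haH : a ∉ H) (hbH : b ∉ H) (hdH : d ∉ H)
    (hba : b ≠ a) (hbc : b ≠ c) (hda : d ≠ a) (hbd : b ≠ d) :
    ¬ LocallySecure D H .pw prop
      (.par {a} (tossing a b c) (highSaturated h a d) : Term A K .nd) := by
  intro hsec
  have hha : some h ∉ some '' {a} := not_mem_image (by rintro rfl; exact haH hhH)
  have hm := (hsec _ _ h hhH (.self _) (.parRight (.altRight (.pre _ _)) hha)).ans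
  have hstuck := AS.of_stuck hm fun l P hact => by
    obtain ⟨Q, rfl, hQ, hl⟩ := act_res.1 hact
    have : l ≠ none := by
      rintro rfl
      simp [act_par, tossing, highSaturated, act_pre, act_alt] at hQ
    exact ⟨this, this⟩
  have hlift := Bisimilar.lift (show Bisimilar D .pw _ _ from hstuck.2)
  obtain ⟨N, hN, hb⟩ := hlift.exists_right (supp_res.2
    ⟨_, supp_par.2 ⟨_, _, supp_one.2 rfl, supp_one.2 rfl, rfl⟩, rfl⟩)
  obtain rfl : (Term.par {a} (tossing a b c) (highSaturated h a d)).res H = N := hN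
  exact not_as_sync hhH haH hbH hdH hba hbc hda hbd (hb.ans_act
    (.res (.synch (.pre _ _) (.altRight (.pre _ _)) ⟨a, rfl, rfl⟩) (not_mem_image haH)))

end

end PNI

/-! ### The theorem -/

theorem theorem4p5 {A : Type u} {K : PNI.Kind → Type v} (D : PNI.Equations A K) (H : Set A) :
    -- prefixing with a low-level action or with `τ`
    (∀ (e : PNI.BisimKind) (prop : PNI.Property) (a : Option A) (E : PNI.Term A K .pr),
      a ∉ some '' H → PNI.Secure D H e prop E → PNI.Secure D H e prop (.pre a E)) ∧
    -- parallel composition for the properties based on `pb`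
    (∀ (prop : PNI.Property) (L : Set A) (k : PNI.Kind) (E₁ E₂ : PNI.Term A K k),
      (L ⊆ Hᶜ ∨ prop = .SBNDC) →
      PNI.Secure D H .pb prop E₁ → PNI.Secure D H .pb prop E₂ →
      PNI.Secure D H .pb prop (.par L E₁ E₂)) ∧
    -- restriction
    (∀ (e : PNI.BisimKind) (prop : PNI.Property) (L : Set A) (k : PNI.Kind)
      (E : PNI.Term A K k),
      PNI.Secure D H e prop E → PNI.Secure D H e prop (E.res L)) ∧
    -- hiding of low-level actions
    (∀ (e : PNI.BisimKind) (prop : PNI.Property) (L : Set A) (k : PNI.Kind)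
      (E : PNI.Term A K k),
      L ⊆ Hᶜ → PNI.Secure D H e prop E → PNI.Secure D H e prop (E.hide L)) ∧
    -- failure of parallel compositionality for the properties based on `pw`
    (∀ h a b c d : A, h ∈ H → a ∉ H → b ∉ H → c ∉ H → d ∉ H → [a, b, c, d].Nodup →
      ∀ prop : PNI.Property, ∃ (E₁ E₂ : PNI.Term A K .nd) (L : Set A), L ⊆ Hᶜ ∧
        PNI.Secure D H .pw prop E₁ ∧ PNI.Secure D H .pw prop E₂ ∧
        ¬ PNI.Secure D H .pw prop (.par L E₁ E₂)) := by

  refine ⟨?_, ?_, ?_, ?_, ?_⟩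
  · intro e prop a E ha hE
    exact PNI.secure_iff.2 (.pre ha (PNI.secure_iff.1 hE))
  · intro prop L k E₁ E₂ hL h₁ h₂
    exact PNI.secure_iff.2 (.par hL (PNI.secure_iff.1 h₁) (PNI.secure_iff.1 h₂))
  · intro e prop L k E hE
    exact PNI.secure_iff.2 ((PNI.isLowContext_res L).locallySecure (PNI.secure_iff.1 hE))
  · intro e prop L k E hL hE
    exact PNI.secure_iff.2 ((PNI.isLowContext_hide hL).locallySecure (PNI.secure_iff.1 hE))
  · intro h a b c d hh ha hb hc hd hnodup prop
    simp only [List.nodup_cons, List.mem_cons, List.not_mem_nil, or_false, not_or] at hnodup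
    obtain ⟨⟨hab, hac, had⟩, ⟨hbc, hbd⟩, -⟩ := hnodup
    refine ⟨PNI.tossing a b c, PNI.highSaturated h a d, {a}, by simpa using ha,
      PNI.secure_iff.2 (PNI.locallySecure_tossing ha hb hc),
      PNI.secure_iff.2 (PNI.locallySecure_highSaturated hh ha hd), fun hsec => ?_⟩
    exact PNI.not_locallySecure_par hh ha hb hd (Ne.symm hab) hbc (Ne.symm had) hbd
      (PNI.secure_iff.1 hsec)
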